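/- Let $N\ge 1$. For $\mathbf b=(b^1,\dots,b^N)\in\mathbb R^N$ put $C^0=\sum_m b^m$, $C^1=\tfrac12\sum_m (b^m)^2+\tfrac N2$ and $\lambda(\mathbf b,q)=(1+q^2)^{-N/2}\prod_{k=1}^N(q-b^k)$. A branch of the inverse function at the parameter value $\lambda\neq 0$ is a continuous function $\mathbf b\mapsto q(\mathbf b,\lambda)$ on an open set $\Omega\subset\mathbb R^N$ with $\lambda(\mathbf b,q(\mathbf b,\lambda))=\lambda$ and $\lambda_q\ne0$ there. For such a branch put $$W_i(\mathbf b,\lambda)=\ln\!\left(\sqrt{1+q^2}-q\right)-q\sqrt{1+q^2}+C^0\,\frac{\sqrt{1+q^2}}{q-b^i}\left(\sum_{m=1}^N\frac1{q-b^m}-\frac{Nq}{1+q^2}\right)^{-1},\qquad q=q(\mathbf b,\lambda).$$ Consider the hydrodynamic type system $$b^k_t=(1+(b^k)^2)\sum_{m} b^m_x-\Big(\sum_n b^n\Big)b^kb^k_x,\qquad k=1,\dots,N, \tag{1}$$ and the algebraic system $$x+t\,(2C^1-C^0b^i)=W_i(\mathbf b,\lambda),\qquad i=1,\dots,N. \tag{2}$$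 (a) Let $\lambda\ne0$, let $q(\cdot,\lambda)$ be a branch on $\Omega$, and let $\mathbf b(x,t)$ be a $C^1$ map from an open set $U\subset\mathbb R^2$ to $\Omega$ with $C^0(\mathbf b)\neq0$ which satisfies (2) on $U$. Then $\mathbf b$ solves (1) on $U$. Moreover, with $g=-C^0(\mathbf b)$, the geodesic flow of the metric $ds^2=g^2dt^2+dx^2$, i.e. the Hamiltonian flow of $H=\frac12(p_1^2/g^2+p_2^2)$, has on $U$ the first integral $$F=\sum_{k=0}^N\frac{(-1)^ka^k}{g^{N-k}}\,p_1^{N-k}p_2^k,\qquad \sum_{k=0}^{N}a^kq^k=\prod_{m=1}^N(q-b^m),$$ a homogeneous polynomial of degree $N$ in the momenta which is not a function of $H$ on any fibre. (b) For every $\lambda_0\neq0$ there are an open set $\Lambda\ni\lambda_0$ of nonzero parameters, an open $\Omega\subset\mathbb R^N$, a nonempty open $U\subset\mathbb R^2$, a branch $q(\mathbf b,\lambda)$ smooth on $\Omega\times\Lambda$, and a smooth family $\mathbf b(x,t,\lambda)\in\Omega$, $(x,t)\in U$, $\lambda\in\Lambda$, with $C^0(\mathbf b)\ne0$, such that for $\mathbf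 b\in\Omega$ system (2) holds if and only if $\mathbf b=\mathbf b(x,t,\lambda)$; if $N\ge2$, the components $b^i(x,t,\lambda)$ are not all equal. Each $\mathbf b(\cdot,\cdot,\lambda)$ solves (1) and gives a metric with a polynomial first integral as in (a). Different $\lambda\in\Lambda$ give different solutions (so (1) has infinitely many such solutions), and, if $\lambda_0\ne1$, different functions $g=-C^0(\mathbf b)$. (c) (Superposition.) The conclusions of (a) hold for every finite $M$, all $\sigma_1,\dots,\sigma_M\in\mathbb R$, all nonzero $\lambda_1,\dots,\lambda_M$ and all branches $q_j(\cdot,\lambda_j)$ on $\Omega$, if (2) is replaced by $$x+t\,(2C^1-C^0b^i)=\sum_{j=1}^M\sigma_jW_i(\mathbf b,\lambda_j),\qquad i=1,\dots,N, \tag{3}$$ where the $j$-th term is formed with the branch $q_j$. (d) For every $M\ge N$ there are nonempty open sets of parameters $(\lambda_1,\dots,\lambda_M)$ (nonzero and pairwise distinct) and $(\sigma_1,\dots,\sigma_M)$, an open $\Omega\subset\mathbb R^N$, a nonempty open $U\subset\mathbb R^2$, smooth branches $q_j(\mathbf b,\lambda_j)$ on $\Omega$, and a smooth family $\mathbf b(x,t,\lambda_1,\dots,\lambda_M,\sigma_1,\dots,\sigma_M)\in\Omega$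 on $U$ with $C^0\neq0$ and pairwise distinct components, such that in $\Omega$ system (3) holds if and only if $\mathbf b$ is the member of this family. All its members solve (1) and give metrics with polynomial first integrals as in (a). If $M=N$, then for fixed $(\lambda_j)$ different $(\sigma_j)$ give different solutions. -/

import Mathlib

open scoped ContDiff

namespace GeodHydro

noncomputable section

/-- `C⁰ = ∑ bᵐ`. -/
def C0 {N : ℕ} (b : Fin N → ℝ) : ℝ := ∑ m, b m

/-- `C¹ = (1/2) ∑ (bᵐ)² + N/2`. -/
def C1 {N : ℕ} (b : Fin N → ℝ) : ℝ := (1 / 2) * ∑ m, b m ^ 2 + (N : ℝ) / 2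

/-- The equation of the Riemann surface: `λ(b, q) = (1 + q²)^(-N/2) ∏ (q - bᵏ)`. -/
def surface {N : ℕ} (b : Fin N → ℝ) (q : ℝ) : ℝ :=
  (1 + q ^ 2) ^ (-(N : ℝ) / 2) * ∏ k, (q - b k)

/-- `q` is a (continuous, local) branch `b ↦ q(b, l)` over the open set `Ω` of the function inverse
to `q ↦ λ(b, q)`, at the value `l` of the parameter: `λ(b, q(b)) = l`, with `λ_q ≠ 0` there. -/
structure IsInverseBranch {N : ℕ} (l : ℝ) (Ω : Set (Fin N → ℝ)) (q : (Fin N → ℝ) → ℝ) : Prop where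
  isOpen : IsOpen Ω
  continuousOn : ContinuousOn q Ω
  surface_eq : ∀ b ∈ Ω, surface b (q b) = l
  deriv_ne_zero : ∀ b ∈ Ω, deriv (surface b) (q b) ≠ 0

/-- The right-hand side `W_i` of the generalized hodograph system. -/
def W {N : ℕ} (b : Fin N → ℝ) (q : ℝ) (i : Fin N) : ℝ :=
  Real.log (√(1 + q ^ 2) - q) - q * √(1 + q ^ 2)
    + C0 b * (√(1 + q ^ 2) / (q - b i))
      * ((∑ m, 1 / (q - b m)) - (N : ℝ) * q / (1 + q ^ 2))⁻¹

/-- The generalized hodograph algebraic system for `b` at the point `(x, t)`. -/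
def Hodograph {N : ℕ} (x t : ℝ) (b : Fin N → ℝ) (q : ℝ) : Prop :=
  ∀ i, x + t * (2 * C1 b - C0 b * b i) = W b q i

/-- The superposed hodograph system, with weights `σ j` and values `q j` of the inverse
function. -/
def SuperHodograph {N M : ℕ} (x t : ℝ) (b : Fin N → ℝ) (σ q : Fin M → ℝ) : Prop :=
  ∀ i, x + t * (2 * C1 b - C0 b * b i) = ∑ j, σ j * W b (q j) i

/-- The partial derivative in `x` of a function of `(x, t)`. -/
def dx (f : ℝ × ℝ → ℝ) (z : ℝ × ℝ) : ℝ := fderiv ℝ f z (1, 0)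

/-- The partial derivative in `t` of a function of `(x, t)`. -/
def dt (f : ℝ × ℝ → ℝ) (z : ℝ × ℝ) : ℝ := fderiv ℝ f z (0, 1)

/-- `b` is a (continuously differentiable) solution on `U` of
`bᵏ_t = (1 + (bᵏ)²) ∑ₘ bᵐ_x - (∑ₙ bⁿ) bᵏ bᵏ_x`. -/
def SolvesSystem {N : ℕ} (U : Set (ℝ × ℝ)) (b : ℝ × ℝ → Fin N → ℝ) : Prop :=
  ContDiffOn ℝ 1 b U ∧
  ∀ z ∈ U, ∀ k,
    dt (fun y => b y k) z
      = (1 + b z k ^ 2) * ∑ m, dx (fun y => b y m) z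
        - (∑ n, b z n) * b z k * dx (fun y => b y k) z

/-- The Hamiltonian of the geodesic flow of the metric `ds² = g² dt² + dx²`. A point of the phase
space is `((x, t), (p₁, p₂))`, where `p₁` is conjugate to `t` and `p₂` to `x`. -/
def Ham (g : ℝ × ℝ → ℝ) (w : (ℝ × ℝ) × (ℝ × ℝ)) : ℝ :=
  (1 / 2) * (w.2.1 ^ 2 / g w.1 ^ 2 + w.2.2 ^ 2)

/-- The Poisson bracket on the phase space. -/
def bracket (F H : (ℝ × ℝ) × (ℝ × ℝ) → ℝ) (w : (ℝ × ℝ) × (ℝ × ℝ)) : ℝ :=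
  fderiv ℝ F w ((0, 0), (1, 0)) * fderiv ℝ H w ((0, 1), (0, 0))
    - fderiv ℝ F w ((0, 1), (0, 0)) * fderiv ℝ H w ((0, 0), (1, 0))
    + fderiv ℝ F w ((0, 0), (0, 1)) * fderiv ℝ H w ((1, 0), (0, 0))
    - fderiv ℝ F w ((1, 0), (0, 0)) * fderiv ℝ H w ((0, 0), (0, 1))

/-- The coefficients `aᵏ` in `∏ (q - bᵐ) = q^N + ∑_{k < N} aᵏ qᵏ`, with `a^N = 1`. -/
def coeffA {N : ℕ} (b : Fin N → ℝ) (k : ℕ) : ℝ :=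
  (∏ m, (Polynomial.X - Polynomial.C (b m))).coeff k

/-- The function `F = ∑ₖ (-1)ᵏ aᵏ g^(-(N-k)) p₁^(N-k) p₂ᵏ`, a homogeneous polynomial of degree `N`
in the momenta. -/
def integralF {N : ℕ} (b : ℝ × ℝ → Fin N → ℝ) (g : ℝ × ℝ → ℝ) (w : (ℝ × ℝ) × (ℝ × ℝ)) : ℝ :=
  ∑ k ∈ Finset.range (N + 1),
    (-1) ^ k * coeffA (b w.1) k / g w.1 ^ (N - k) * w.2.1 ^ (N - k) * w.2.2 ^ k

/-- With `g = -C⁰(b)`, the quadratic form `g² dt² + dx²` is a `C¹` Riemannian metric on `U`, the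
polynomial `F` is a first integral of its geodesic flow, and `F` is not a function of the
Hamiltonian on any fibre of the cotangent bundle. -/
def HasPolynomialIntegral {N : ℕ} (U : Set (ℝ × ℝ)) (b : ℝ × ℝ → Fin N → ℝ) : Prop :=
  let g : ℝ × ℝ → ℝ := fun z => -C0 (b z)
  ContDiffOn ℝ 1 g U ∧ (∀ z ∈ U, g z ≠ 0) ∧
  ContDiffOn ℝ 1 (integralF b g) (U ×ˢ Set.univ) ∧
  (∀ z ∈ U, ∀ p : ℝ × ℝ, bracket (integralF b g) (Ham g) (z, p) = 0) ∧
  (∀ z ∈ U, ∃ p p' : ℝ × ℝ, Ham g (z, p) = Ham g (z, p') ∧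
    integralF b g (z, p) ≠ integralF b g (z, p'))

end

end GeodHydro

open GeodHydro

/-! ### The first integral as a product of linear forms. -/

namespace GeodHydro

/-! The integral factors: up to sign, `F` is the product of the linear forms ℓ_m = p₂ + b_m p₁/g.
System (1) says that each ℓ_m is a Darboux factor, {ℓ_m, H} = κ_m ℓ_m, and the cofactors κ_m add up
to zero because g = -∑ b_m. Hence `F` Poisson commutes with H
(`SolvesSystem.hasPolynomialIntegral`).

To see that (2) and (3) give solutions of (1), put G = -`primA`/2, so that G' = √(1+q²). Since ∂_i q
= 1/((q - b_i) `logD`) along a branch, W_i = C⁰ ∂_i G(q(b)) - 2 G(q(b)). As ∂_i C¹ = b_i, the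
hodograph system becomes x = C⁰ ∂_i Φ - 2Φ for all i, with the potential Φ = ∑ σ_j G(q_j(b)) + t C¹.
It therefore says that all ∂_i Φ have one common value θ = (x + 2Φ)/C⁰. Differentiating, b_x and b_t
satisfy Q b_x = (1,…,1) and Q b_t = (2C¹ - C⁰ b_i), where Q = C⁰ Hess Φ - θ 1 1ᵀ. A linear
second-order equation satisfied by each G(q_j(b)) (`hess_identity`) and by C¹ makes Q V symmetric, V
being the velocity matrix of (1). The second right-hand side is Vᵀ(1,…,1), so Q(b_t - V b_x) = 0.

Q is not assumed invertible. `velocity_eq` shows nevertheless that its kernel contains no nonzero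
vector that is constant on groups of equal b_i. The vector b_t - V b_x has this form wherever the
pattern of equalities among the b_i is locally constant. Such points are dense
(`exists_locally_constant_pattern`), and continuity gives (1) everywhere.

The families come from the implicit function theorem at explicit base points. For a single λ, the
base point has q = 0 and -1/b_i equal to a (n = N - 1 times) or c (once). With at most two distinct
values the equations can be solved for (x, t), and the linearization reduces to two unknowns
(`base_velocity`). The same computation with λ moving shows that the solution, and generically C⁰,
has nonzero λ-derivative. For superpositions, the base point lies at all λ_j = 0. There the branches
are the roots b_k themselves, W_i has the explicit limit in `exists_root_branch`, and the
linearization is diagonal (`superDefect_kernel`). Nonzero distinct λ_j are then taken near 0. -/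

theorem fin_prod_const_mul {N : ℕ} (c : ℝ) (f : Fin N → ℝ) : ∏ m, c * f m = c ^ N * ∏ m, f m := by
  simp [Finset.prod_mul_distrib]

/-- Homogenization of ∏ (q - b_m) at q = w/u. The case u = 0 is separate: only the leading
coefficient survives there. -/
theorem sum_coeff_prod_X_sub_C {N : ℕ} (b : Fin N → ℝ) (u w : ℝ) :
    ∑ k ∈ Finset.range (N + 1), coeffA b k * u ^ (N - k) * w ^ k = ∏ m, (w - b m * u) := by
  have hdeg : (∏ m, (Polynomial.X - Polynomial.C (b m))).natDegree = N := by
    simp [Polynomial.natDegree_prod_of_monic _ _ (fun i _ => Polynomial.monic_X_sub_C (b i))]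
  by_cases hu : u = 0
  · subst hu
    rw [Finset.sum_eq_single N]
    · have hmonic : (∏ m, (Polynomial.X - Polynomial.C (b m))).Monic :=
        Polynomial.monic_prod_of_monic _ _ (fun i _ => Polynomial.monic_X_sub_C (b i))
      have : coeffA b N = 1 := by
        have h := hmonic.coeff_natDegree
        rwa [hdeg] at h
      simp [this]
    · intro k hk hkN
      have : N - k ≠ 0 := by have := Finset.mem_range.1 hk; omega
      simp [this]
    · simp
  · have h1 : ∏ m, (w - b m * u) = u ^ N * ∏ m, (w / u - b m) := by
      rw [← fin_prod_const_mul]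
      refine Finset.prod_congr rfl fun m _ => ?_
      field_simp
    have h2 : ∏ m, (w / u - b m) = (∏ m, (Polynomial.X - Polynomial.C (b m))).eval (w / u) := by
      simp [Polynomial.eval_prod]
    rw [h1, h2, Polynomial.eval_eq_sum_range' (n := N + 1) (by omega), Finset.mul_sum]
    refine Finset.sum_congr rfl fun k hk => ?_
    have hk' : k ≤ N := by have := Finset.mem_range.1 hk; omega
    have hpow : u ^ N = u ^ (N - k) * u ^ k := by rw [← pow_add, Nat.sub_add_cancel hk']
    rw [div_pow, hpow]
    simp only [coeffA]
    field_simp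

/-- The first integral is a product of linear forms in the momenta. -/
theorem integralF_eq_prod {N : ℕ} (b : ℝ × ℝ → Fin N → ℝ) (g : ℝ × ℝ → ℝ)
    (w : (ℝ × ℝ) × (ℝ × ℝ)) :
    integralF b g w = (-1) ^ N * ∏ m, (w.2.2 + b w.1 m * w.2.1 / g w.1) := by
  have h := sum_coeff_prod_X_sub_C (b w.1) (w.2.1 / g w.1) (-w.2.2)
  have h2 : ∏ m, (-w.2.2 - b w.1 m * (w.2.1 / g w.1))
      = (-1) ^ N * ∏ m, (w.2.2 + b w.1 m * w.2.1 / g w.1) := by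
    rw [← fin_prod_const_mul]
    refine Finset.prod_congr rfl fun m _ => ?_
    ring
  rw [← h2, ← h]
  refine Finset.sum_congr rfl fun k _ => ?_
  rw [neg_pow w.2.2, div_pow]
  ring

/-- The linear form in the momenta attached to the component `m`. -/
noncomputable def linForm {N : ℕ} (b : ℝ × ℝ → Fin N → ℝ) (g : ℝ × ℝ → ℝ) (m : Fin N)
    (w : (ℝ × ℝ) × (ℝ × ℝ)) : ℝ := w.2.2 + b w.1 m * w.2.1 / g w.1

theorem hasFDerivAt_linForm {N : ℕ} {b : ℝ × ℝ → Fin N → ℝ} {g : ℝ × ℝ → ℝ} {m : Fin N}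
    {z p : ℝ × ℝ} (hb : DifferentiableAt ℝ (fun y => b y m) z) (hg : DifferentiableAt ℝ g z)
    (hgz : g z ≠ 0) :
    ∃ L : ((ℝ × ℝ) × (ℝ × ℝ)) →L[ℝ] ℝ, HasFDerivAt (linForm b g m) L (z, p) ∧
      ∀ v : (ℝ × ℝ) × (ℝ × ℝ), L v = v.2.2 + b z m * v.2.1 / g z
        + p.1 * (fderiv ℝ (fun y => b y m) z v.1 / g z - b z m * fderiv ℝ g z v.1 / g z ^ 2) := by
  have h1 : HasFDerivAt (fun w : (ℝ × ℝ) × (ℝ × ℝ) => b w.1 m) _ (z, p) :=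
    HasFDerivAt.comp (g := fun y => b y m) (z, p) hb.hasFDerivAt hasFDerivAt_fst
  have h2 : HasFDerivAt (fun w : (ℝ × ℝ) × (ℝ × ℝ) => g w.1) _ (z, p) :=
    HasFDerivAt.comp (g := g) (z, p) hg.hasFDerivAt hasFDerivAt_fst
  have h3 := (hasFDerivAt_snd (𝕜 := ℝ) (p := (z, p))).fst
  have h4 := (hasFDerivAt_snd (𝕜 := ℝ) (p := (z, p))).snd
  refine ⟨_, h4.add ((h1.mul h3).mul ((hasDerivAt_inv hgz).comp_hasFDerivAt (z, p) h2)), ?_⟩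
  intro v
  simp
  field_simp
  ring

theorem hasFDerivAt_ham {g : ℝ × ℝ → ℝ} {z p : ℝ × ℝ} (hg : DifferentiableAt ℝ g z)
    (hgz : g z ≠ 0) :
    ∃ L : ((ℝ × ℝ) × (ℝ × ℝ)) →L[ℝ] ℝ, HasFDerivAt (Ham g) L (z, p) ∧
      ∀ v : (ℝ × ℝ) × (ℝ × ℝ), L v = p.1 * v.2.1 / g z ^ 2 + p.2 * v.2.2
        - p.1 ^ 2 * fderiv ℝ g z v.1 / g z ^ 3 := by
  have h2 : HasFDerivAt (fun w : (ℝ × ℝ) × (ℝ × ℝ) => g w.1) _ (z, p) :=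
    HasFDerivAt.comp (g := g) (z, p) hg.hasFDerivAt hasFDerivAt_fst
  have h3 := (hasFDerivAt_snd (𝕜 := ℝ) (p := (z, p))).fst
  have h4 := (hasFDerivAt_snd (𝕜 := ℝ) (p := (z, p))).snd
  refine ⟨_, (((h3.pow 2).mul ((hasDerivAt_inv (pow_ne_zero 2 hgz)).comp_hasFDerivAt (z, p)
    (h2.pow 2))).add (h4.pow 2)).const_mul (1 / 2), ?_⟩
  intro v
  simp
  field_simp
  ring

theorem contDiffOn_C0 {N : ℕ} {U : Set (ℝ × ℝ)} {b : ℝ × ℝ → Fin N → ℝ} (hb : ContDiffOn ℝ 1 b U) :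
    ContDiffOn ℝ 1 (fun z => C0 (b z)) U := by
  unfold C0
  exact ContDiffOn.sum fun m _ => (contDiffOn_pi.1 hb) m

/-- A solution of the hydrodynamic type system with `C⁰ ≠ 0` yields a polynomial integral. -/
theorem SolvesSystem.hasPolynomialIntegral {N : ℕ} (hN : 1 ≤ N) {U : Set (ℝ × ℝ)} (hU : IsOpen U)
    {b : ℝ × ℝ → Fin N → ℝ} (hs : SolvesSystem U b) (h0 : ∀ z ∈ U, C0 (b z) ≠ 0) :
    HasPolynomialIntegral U b := by
  obtain ⟨hb, heq⟩ := hs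
  have hbm : ∀ m, ContDiffOn ℝ 1 (fun z => b z m) U := contDiffOn_pi.1 hb
  have hg : ContDiffOn ℝ 1 (fun z => -C0 (b z)) U := (contDiffOn_C0 hb).neg
  have hg0 : ∀ z ∈ U, -C0 (b z) ≠ 0 := fun z hz => neg_ne_zero.2 (h0 z hz)
  have hF : integralF b (fun z => -C0 (b z))
      = fun w => (-1) ^ N * ∏ m, linForm b (fun z => -C0 (b z)) m w := by
    funext w
    exact integralF_eq_prod _ _ _
  refine ⟨hg, hg0, ?_, ?_, ?_⟩
  · rw [hF]
    have hfst : Set.MapsTo (Prod.fst : (ℝ × ℝ) × (ℝ × ℝ) → ℝ × ℝ) (U ×ˢ Set.univ) U :=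
      fun w hw => hw.1
    refine contDiffOn_const.mul (contDiffOn_prod fun m _ => ?_)
    unfold linForm
    refine ContDiffOn.add (contDiff_snd.comp contDiff_snd).contDiffOn ?_
    refine ContDiffOn.div (ContDiffOn.mul ((hbm m).comp contDiff_fst.contDiffOn hfst)
      (contDiff_fst.comp contDiff_snd).contDiffOn) (hg.comp contDiff_fst.contDiffOn hfst)
      fun w hw => hg0 _ hw.1
  · intro z hz p
    have hbd : ∀ m, DifferentiableAt ℝ (fun y => b y m) z := fun m =>
      ((hbm m).contDiffAt (hU.mem_nhds hz)).differentiableAt (by simp)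
    have hgd : DifferentiableAt ℝ (fun z => -C0 (b z)) z :=
      (hg.contDiffAt (hU.mem_nhds hz)).differentiableAt (by simp)
    have hgf : ∀ v, fderiv ℝ (fun z => -C0 (b z)) z v = -∑ m, fderiv ℝ (fun y => b y m) z v := by
      intro v
      have : HasFDerivAt (fun z => -C0 (b z)) (-∑ m, fderiv ℝ (fun y => b y m) z) z := by
        unfold C0
        exact (HasFDerivAt.fun_sum fun m _ => (hbd m).hasFDerivAt).neg
      rw [this.fderiv]
      simp
    set g : ℝ × ℝ → ℝ := fun z => -C0 (b z) with hgdef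
    have hgz : g z ≠ 0 := hg0 z hz
    choose L hL hLv using fun m => hasFDerivAt_linForm (p := p) (hbd m) hgd hgz
    obtain ⟨LH, hLH, hLHv⟩ := hasFDerivAt_ham (p := p) hgd hgz
    have hprod : HasFDerivAt (integralF b g) ((-1 : ℝ) ^ N •
        ∑ m, (∏ j ∈ Finset.univ.erase m, linForm b g j (z, p)) • L m) (z, p) := by
      rw [hF]
      exact (HasFDerivAt.finsetProd (u := Finset.univ) fun m _ => hL m).const_mul ((-1 : ℝ) ^ N)
    -- The Darboux property {ℓ_m, H} = κ_m ℓ_m; this is where equation (1) for the m-th component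
    -- enters.
    have hlin : ∀ m, L m ((0, 0), (1, 0)) * LH ((0, 1), (0, 0))
        - L m ((0, 1), (0, 0)) * LH ((0, 0), (1, 0))
        + L m ((0, 0), (0, 1)) * LH ((1, 0), (0, 0))
        - L m ((1, 0), (0, 0)) * LH ((0, 0), (0, 1))
        = -(p.1 / g z ^ 2) * (g z * dx (fun y => b y m) z - b z m * dx g z)
          * linForm b g m (z, p) := by
      intro m
      have hm := heq z hz m
      have hS : ∑ m, dx (fun y => b y m) z = -dx g z := by
        simp only [dx, hgf, neg_neg]
      have hC : ∑ n, b z n = -g z := by simp [hgdef, C0]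
      rw [hS, hC] at hm
      simp only [hLv, hLHv, linForm]
      simp only [dx, dt] at hm ⊢
      rw [hm]
      simp only [Prod.mk_zero_zero, map_zero]
      field_simp
      ring
    -- The cofactors cancel: both ∑ b_m = -g and ∑ ∂_x b_m = -g_x.
    have hsum : ∑ m, (g z * dx (fun y => b y m) z - b z m * dx g z) = 0 := by
      rw [Finset.sum_sub_distrib, ← Finset.mul_sum, ← Finset.sum_mul]
      have hC : ∑ n, b z n = -g z := by simp [hgdef, C0]
      simp only [dx, hgf, hC]
      ring
    have herase : ∀ m, (∏ j ∈ Finset.univ.erase m, linForm b g j (z, p)) * linForm b g m (z, p)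
        = ∏ j, linForm b g j (z, p) := fun m => Finset.prod_erase_mul _ _ (Finset.mem_univ m)
    unfold bracket
    rw [hprod.fderiv, hLH.fderiv]
    simp only [smul_apply, sum_apply, smul_eq_mul,
      Finset.mul_sum, Finset.sum_mul, ← Finset.sum_sub_distrib, ← Finset.sum_add_distrib]
    calc _ = ∑ m, (-1) ^ N * (∏ j, linForm b g j (z, p)) * (-(p.1 / g z ^ 2))
          * (g z * dx (fun y => b y m) z - b z m * dx g z) := by
          refine Finset.sum_congr rfl fun m _ => ?_
          rw [← herase m]
          linear_combination (-1) ^ N * (∏ j ∈ Finset.univ.erase m, linForm b g j (z, p)) * hlin m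
      _ = 0 := by rw [← Finset.mul_sum, hsum, mul_zero]
  · intro z hz
    have hgz := hg0 z hz
    -- The second covector is a zero of the first linear form, so F vanishes on it. The first lies
    -- on the same level of H with p₁ = 0, where F is ± a power of p₂ ≠ 0.
    refine ⟨(0, √(1 + b z ⟨0, hN⟩ ^ 2)), (-C0 (b z), -b z ⟨0, hN⟩), ?_, ?_⟩
    · have : (0 : ℝ) ≤ 1 + b z ⟨0, hN⟩ ^ 2 := by positivity
      simp only [Ham]
      rw [Real.sq_sqrt this, div_self (pow_ne_zero 2 hgz)]
      ring
    · have h2 : ∏ m, (-b z ⟨0, hN⟩ + b z m * -C0 (b z) / -C0 (b z)) = 0 := by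
        apply Finset.prod_eq_zero (Finset.mem_univ (⟨0, hN⟩ : Fin N))
        rw [mul_div_assoc, div_self hgz]
        ring
      have h3 : √(1 + b z ⟨0, hN⟩ ^ 2) ≠ 0 := by positivity
      rw [integralF_eq_prod, integralF_eq_prod]
      simp only
      rw [h2]
      simp [h3]

end GeodHydro

/-! ### Implicit functions on product neighbourhoods. -/

open Filter Topology in
/-- A product-neighbourhood form of the analytic implicit function theorem. -/
theorem exists_implicit_family {P E : Type*} [NormedAddCommGroup P] [NormedSpace ℝ P]
    [CompleteSpace P] [NormedAddCommGroup E] [NormedSpace ℝ E] [FiniteDimensional ℝ E]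
    {f : P × E → E} {p₀ : P} {e₀ : E} (hf : ContDiffAt ℝ ω f (p₀, e₀)) (h0 : f (p₀, e₀) = 0)
    (hker : ∀ u, fderiv ℝ f (p₀, e₀) (0, u) = 0 → u = 0) {O : Set (P × E)}
    (hO : O ∈ 𝓝 (p₀, e₀)) :
    ∃ (A : Set P) (B : Set E) (β : P → E), IsOpen A ∧ IsOpen B ∧ p₀ ∈ A ∧ e₀ ∈ B ∧
      ContDiffOn ℝ ω β A ∧ A ×ˢ B ⊆ O ∧ (∀ p ∈ A, β p ∈ B) ∧
      ∀ p ∈ A, ∀ e ∈ B, f (p, e) = 0 ↔ e = β p := by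
  have : CompleteSpace E := FiniteDimensional.complete ℝ E
  -- In finite dimension an injective endomorphism is invertible, so a trivial kernel is all that
  -- has to be checked at the base points.
  have hinv : (fderiv ℝ f (p₀, e₀) ∘L .inr ℝ P E).IsInvertible := by
    have hinj : Function.Injective (fderiv ℝ f (p₀, e₀) ∘L .inr ℝ P E) := by
      rw [injective_iff_map_eq_zero]
      intro u hu
      exact hker u (by simpa using hu)
    refine ⟨(LinearEquiv.ofInjectiveEndo
      ((fderiv ℝ f (p₀, e₀) ∘L .inr ℝ P E : E →L[ℝ] E) : E →ₗ[ℝ] E) hinj).toContinuousLinearEquiv,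
      ?_⟩
    ext u
    rfl
  have hω : (ω : WithTop ℕ∞) ≠ 0 := by simp
  set β := hf.implicitFunction hω hinv
  have hβ0 : β p₀ = e₀ := hf.implicitFunction_apply_self hω hinv
  have hβ : ContDiffAt ℝ ω β p₀ := hf.contDiffAt_implicitFunction hω hinv
  have hiff := hf.eventually_apply_eq_iff_implicitFunction hω hinv
  have hev : ∀ᶠ v in 𝓝 (p₀, e₀), v ∈ O ∧ (f v = 0 ↔ v.2 = β v.1) := by
    filter_upwards [hiff, hO] with v hv hvO
    exact ⟨hvO, by rw [← h0, hv, eq_comm]⟩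
  obtain ⟨A₀, B, hA₀, hpA₀, hB, heB, hsub⟩ := mem_nhds_prod_iff'.1 hev
  have hA1 : ∀ᶠ p in 𝓝 p₀, p ∈ A₀ ∧ ContDiffAt ℝ ω β p ∧ β p ∈ B := by
    filter_upwards [hA₀.mem_nhds hpA₀, hβ.eventually (by simp),
      hβ.continuousAt.preimage_mem_nhds (hB.mem_nhds (by rw [hβ0]; exact heB))] with p h1 h2 h3
    exact ⟨h1, h2, h3⟩
  obtain ⟨A, hAsub, hA, hpA⟩ := mem_nhds_iff.1 hA1
  exact ⟨A, B, β, hA, hB, hpA, heB, fun p hp => (hAsub hp).2.1.contDiffWithinAt,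
    fun v hv => (hsub ⟨(hAsub hv.1).1, hv.2⟩).1, fun p hp => (hAsub hp).2.2,
    fun p hp e he => (hsub (a := (p, e)) ⟨(hAsub hp).1, he⟩).2⟩

/-! ### Derivatives along curves of points, branches and parameters. -/

namespace GeodHydro

variable {N : ℕ}

/-- The logarithmic derivative in `q` of the surface function. -/
noncomputable def logD (b : Fin N → ℝ) (q : ℝ) : ℝ :=
  (∑ m, 1 / (q - b m)) - (N : ℝ) * q / (1 + q ^ 2)

theorem one_add_sq_ne_zero (q : ℝ) : 1 + q ^ 2 ≠ 0 := by positivity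

theorem sqrt_one_add_sq_sq (q : ℝ) : √(1 + q ^ 2) ^ 2 = 1 + q ^ 2 := Real.sq_sqrt (by positivity)

theorem sqrt_one_add_sq_ne_zero (q : ℝ) : √(1 + q ^ 2) ≠ 0 := by positivity

theorem sqrt_one_add_sq_sub_pos (q : ℝ) : 0 < √(1 + q ^ 2) - q := by
  have h : |q| < √(1 + q ^ 2) := by
    rw [← Real.sqrt_sq_eq_abs]
    exact Real.sqrt_lt_sqrt (by positivity) (by linarith)
  linarith [le_abs_self q]

theorem sub_ne_zero_of_surface_ne_zero {b : Fin N → ℝ} {q : ℝ} (h : surface b q ≠ 0) (m : Fin N) :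
    q - b m ≠ 0 := by
  intro hm
  apply h
  unfold surface
  rw [Finset.prod_eq_zero (Finset.mem_univ m) hm, mul_zero]

theorem hasDerivAt_surface_curve {c : ℝ → Fin N → ℝ} {q : ℝ → ℝ} {v : Fin N → ℝ} {q' τ : ℝ}
    (hc : HasDerivAt c v τ) (hq : HasDerivAt q q' τ) (h0 : ∀ m, q τ - c τ m ≠ 0) :
    HasDerivAt (fun r => surface (c r) (q r))
      (surface (c τ) (q τ) * (logD (c τ) (q τ) * q' - ∑ m, v m / (q τ - c τ m))) τ := by
  have hcm := hasDerivAt_pi.1 hc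
  have h1 := (((hq.pow 2).const_add 1).rpow_const (p := -(N : ℝ) / 2)
    (Or.inl (by simpa using one_add_sq_ne_zero (q τ))))
  have h2 := HasDerivAt.fun_finsetProd (u := Finset.univ) fun m _ => hq.sub (hcm m)
  refine (h1.mul h2).congr_deriv ?_
  have h3 : ∀ m, (∏ j ∈ Finset.univ.erase m, (q τ - c τ j))
      = (∏ j, (q τ - c τ j)) * (1 / (q τ - c τ m)) := fun m => by
    rw [← Finset.prod_erase_mul _ _ (Finset.mem_univ m)]
    field_simp [h0 m]
  have h4 : (1 + q τ ^ 2) ^ (-(N : ℝ) / 2 - 1)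
      = (1 + q τ ^ 2) ^ (-(N : ℝ) / 2) / (1 + q τ ^ 2) := by
    rw [Real.rpow_sub_one (one_add_sq_ne_zero _)]
  simp only [Pi.sub_apply, Pi.pow_apply, smul_eq_mul, h3, h4, surface, logD]
  have h5 : ∑ x, (∏ j, (q τ - c τ j)) * (1 / (q τ - c τ x)) * (q' - v x)
      = (∏ j, (q τ - c τ j)) * ((∑ x, 1 / (q τ - c τ x)) * q' - ∑ m, v m / (q τ - c τ m)) := by
    rw [Finset.sum_mul, ← Finset.sum_sub_distrib, Finset.mul_sum]
    refine Finset.sum_congr rfl fun x _ => ?_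
    ring
  rw [h5]
  have := one_add_sq_ne_zero (q τ)
  field_simp
  ring

theorem deriv_surface {b : Fin N → ℝ} {q : ℝ} (h0 : ∀ m, q - b m ≠ 0) :
    deriv (surface b) q = surface b q * logD b q := by
  have h := hasDerivAt_surface_curve (c := fun _ => b) (hasDerivAt_const q b) (hasDerivAt_id q) h0
  have h' : HasDerivAt (surface b) _ q := h
  rw [h'.deriv]
  simp

/-- Logarithmic differentiation of λ(b, q) = l. For constant l it gives ∂_m q = 1/((q - b_m)
`logD`). The term l'/l is kept for the one-parameter family, where the parameter itself moves. -/
theorem speed_eq {c : ℝ → Fin N → ℝ} {q l : ℝ → ℝ} {v : Fin N → ℝ} {q' l' τ : ℝ}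
    (hc : HasDerivAt c v τ) (hq : HasDerivAt q q' τ) (hl : HasDerivAt l l' τ)
    (hs : ∀ᶠ r in nhds τ, surface (c r) (q r) = l r) (hl0 : l τ ≠ 0) :
    logD (c τ) (q τ) * q' = ∑ m, v m / (q τ - c τ m) + l' / l τ := by
  have hτ := hs.self_of_nhds
  have h0 := fun m => sub_ne_zero_of_surface_ne_zero (hτ.trans_ne hl0) m
  have h := (hasDerivAt_surface_curve hc hq h0).congr_of_eventuallyEq
    (hs.mono fun r hr => hr.symm)
  have h2 := h.unique hl
  rw [hτ] at h2
  field_simp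
  linarith

/-- The part of `W` that depends on `q` only. -/
noncomputable def primA (q : ℝ) : ℝ := Real.log (√(1 + q ^ 2) - q) - q * √(1 + q ^ 2)

theorem hasDerivAt_sqrt_one_add_sq {q : ℝ → ℝ} {q' τ : ℝ} (hq : HasDerivAt q q' τ) :
    HasDerivAt (fun r => √(1 + q r ^ 2)) (√(1 + q τ ^ 2) * (q τ / (1 + q τ ^ 2)) * q') τ := by
  refine (((hq.pow 2).const_add 1).sqrt (by simpa using one_add_sq_ne_zero (q τ))).congr_deriv ?_
  have h1 := sqrt_one_add_sq_ne_zero (q τ)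
  have h2 := sqrt_one_add_sq_sq (q τ)
  have h3 := one_add_sq_ne_zero (q τ)
  simp only [Pi.pow_apply]
  field_simp
  rw [h2]
  push_cast
  ring

/-- This identifies `primA` with -2G, where G' = √(1+q²), and so gives W the form C⁰ ∂_i G - 2G. -/
theorem hasDerivAt_primA {q : ℝ → ℝ} {q' τ : ℝ} (hq : HasDerivAt q q' τ) :
    HasDerivAt (fun r => primA (q r)) (-2 * √(1 + q τ ^ 2) * q') τ := by
  have hs := hasDerivAt_sqrt_one_add_sq hq
  have h0 := (sqrt_one_add_sq_sub_pos (q τ)).ne'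
  refine (((hs.sub hq).log h0).sub (hq.mul hs)).congr_deriv ?_
  have h1 := sqrt_one_add_sq_ne_zero (q τ)
  have h2 := sqrt_one_add_sq_sq (q τ)
  have h3 := one_add_sq_ne_zero (q τ)
  simp only [Pi.sub_apply]
  rw [← h2] at h3 ⊢
  rw [Real.sqrt_sq (Real.sqrt_nonneg _)] at *
  field_simp
  linear_combination (q' * √(1 + q τ ^ 2) - q' * q τ) * h2

/-- The derivative of `logD` along a curve with velocity `(v, q')`. -/
noncomputable def logDDot (b : Fin N → ℝ) (q : ℝ) (v : Fin N → ℝ) (q' : ℝ) : ℝ :=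
  -(∑ m, (q' - v m) / (q - b m) ^ 2) - N * (1 - q ^ 2) / (1 + q ^ 2) ^ 2 * q'

theorem hasDerivAt_logD {c : ℝ → Fin N → ℝ} {q : ℝ → ℝ} {v : Fin N → ℝ} {q' τ : ℝ}
    (hc : HasDerivAt c v τ) (hq : HasDerivAt q q' τ) (h0 : ∀ m, q τ - c τ m ≠ 0) :
    HasDerivAt (fun r => logD (c r) (q r)) (logDDot (c τ) (q τ) v q') τ := by
  have hcm := hasDerivAt_pi.1 hc
  have h1 := HasDerivAt.fun_sum (u := Finset.univ) fun m _ =>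
    (hasDerivAt_const τ (1 : ℝ)).div (hq.sub (hcm m)) (h0 m)
  have h2 := (hq.const_mul (N : ℝ)).div ((hq.pow 2).const_add 1)
    (by simpa using one_add_sq_ne_zero (q τ))
  refine (h1.sub h2).congr_deriv ?_
  unfold logDDot
  rw [← Finset.sum_neg_distrib]
  have h3 := one_add_sq_ne_zero (q τ)
  congr 1
  · refine Finset.sum_congr rfl fun m _ => ?_
    simp only [Pi.sub_apply]
    ring
  · simp only [Pi.pow_apply]
    field_simp
    push_cast
    ring

/-- The derivative of `W` along a curve with velocity `(v, q')`. -/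
noncomputable def wDot (b : Fin N → ℝ) (q : ℝ) (v : Fin N → ℝ) (q' : ℝ) (i : Fin N) : ℝ :=
  √(1 + q ^ 2) * (-2 * q' + (∑ m, v m) * (1 / (q - b i)) / logD b q
    + C0 b * (q / (1 + q ^ 2) * q' / (q - b i) / logD b q
      - (q' - v i) / (q - b i) ^ 2 / logD b q
      - logDDot b q v q' / (q - b i) / logD b q ^ 2))

theorem hasDerivAt_C0 {c : ℝ → Fin N → ℝ} {v : Fin N → ℝ} {τ : ℝ} (hc : HasDerivAt c v τ) :
    HasDerivAt (fun r => C0 (c r)) (∑ m, v m) τ :=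
  HasDerivAt.fun_sum fun m _ => hasDerivAt_pi.1 hc m

theorem hasDerivAt_C1 {c : ℝ → Fin N → ℝ} {v : Fin N → ℝ} {τ : ℝ} (hc : HasDerivAt c v τ) :
    HasDerivAt (fun r => C1 (c r)) (∑ m, c τ m * v m) τ := by
  have h := ((HasDerivAt.fun_sum (u := Finset.univ) fun m _ =>
    (hasDerivAt_pi.1 hc m).pow 2).const_mul (1 / 2 : ℝ)).add_const ((N : ℝ) / 2)
  refine h.congr_deriv ?_
  rw [Finset.mul_sum]
  refine Finset.sum_congr rfl fun m _ => ?_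
  push_cast
  ring

theorem hasDerivAt_W {c : ℝ → Fin N → ℝ} {q : ℝ → ℝ} {v : Fin N → ℝ} {q' τ : ℝ}
    (hc : HasDerivAt c v τ) (hq : HasDerivAt q q' τ) (h0 : ∀ m, q τ - c τ m ≠ 0)
    (hP : logD (c τ) (q τ) ≠ 0) (i : Fin N) :
    HasDerivAt (fun r => W (c r) (q r) i) (wDot (c τ) (q τ) v q' i) τ := by
  have hs := hasDerivAt_sqrt_one_add_sq hq
  have h := (hasDerivAt_primA hq).add (((hasDerivAt_C0 hc).mul
    (hs.div (hq.sub (hasDerivAt_pi.1 hc i)) (h0 i))).mul ((hasDerivAt_logD hc hq h0).inv hP))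
  refine h.congr_deriv ?_
  have h1 := h0 i
  have h3 := one_add_sq_ne_zero (q τ)
  simp only [Pi.sub_apply, Pi.mul_apply, Pi.div_apply, Pi.inv_apply, wDot]
  field_simp
  ring

/-- The left-hand side of the hodograph system has the expected derivative along a curve. -/
theorem hasDerivAt_hodographLHS {c : ℝ → Fin N → ℝ} {x t : ℝ → ℝ} {v : Fin N → ℝ} {x' t' τ : ℝ}
    (hc : HasDerivAt c v τ) (hx : HasDerivAt x x' τ) (ht : HasDerivAt t t' τ) (i : Fin N) :
    HasDerivAt (fun r => x r + t r * (2 * C1 (c r) - C0 (c r) * c r i))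
      (x' + t' * (2 * C1 (c τ) - C0 (c τ) * c τ i)
        + t τ * (2 * (∑ m, c τ m * v m) - (∑ m, v m) * c τ i - C0 (c τ) * v i)) τ := by
  refine (hx.add (ht.mul (((hasDerivAt_C1 hc).const_mul 2).sub
    ((hasDerivAt_C0 hc).mul (hasDerivAt_pi.1 hc i))))).congr_deriv ?_
  simp only [Pi.sub_apply, Pi.mul_apply]
  ring

end GeodHydro

/-! ### The second-order equation for the potential, and the algebra of the velocity matrix. -/

namespace GeodHydro

variable {N : ℕ}

/-- The gradient `∂ᵢ G(q(b))`, `G' = √(1 + q²)`, up to the factor `√(1 + q²)`. -/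
noncomputable def grad (b : Fin N → ℝ) (q : ℝ) (i : Fin N) : ℝ := 1 / (q - b i) / logD b q

/-- The derivative `∂ₘ (√(1 + q²) / logD)` up to the factor `√(1 + q²)`. -/
noncomputable def gradAux (b : Fin N → ℝ) (q : ℝ) (m : Fin N) : ℝ :=
  q / (1 + q ^ 2) * (1 / (q - b m)) / logD b q ^ 2
    - ((1 / (q - b m)) ^ 2 + 1 / (q - b m) / logD b q *
      (-(∑ k, (1 / (q - b k)) ^ 2) - N * (1 - q ^ 2) / (1 + q ^ 2) ^ 2)) / logD b q ^ 2

/-- The Hessian `∂ᵢ∂ₘ G(q(b))` up to the factor `√(1 + q²)`. -/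
noncomputable def hess (b : Fin N → ℝ) (q : ℝ) (i m : Fin N) : ℝ :=
  1 / (q - b i) * gradAux b q m - (1 / (q - b i)) ^ 2 * (1 / (q - b m)) / logD b q ^ 2
    + if i = m then (1 / (q - b i)) ^ 2 / logD b q else 0

theorem hess_symm (b : Fin N → ℝ) (q : ℝ) (i m : Fin N) : hess b q i m = hess b q m i := by
  unfold hess gradAux
  by_cases h : i = m
  · subst h
    rfl
  · rw [if_neg h, if_neg (Ne.symm h)]
    ring

/-- The product rule for W_i = -2G + C⁰ ∂_i G, with q' eliminated: the velocity enters only through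
the gradient and Hessian of G. -/
theorem wDot_eq {b : Fin N → ℝ} {q : ℝ} {v : Fin N → ℝ} {q' : ℝ} (hP : logD b q ≠ 0)
    (hq' : logD b q * q' = ∑ m, v m / (q - b m)) (i : Fin N) :
    wDot b q v q' i = √(1 + q ^ 2) * (-2 * (∑ m, grad b q m * v m) + (∑ m, v m) * grad b q i
      + C0 b * ∑ m, hess b q i m * v m) := by
  have hq'' : q' = (∑ m, 1 / (q - b m) * v m) / logD b q := by
    rw [eq_div_iff hP, mul_comm, hq']
    exact Finset.sum_congr rfl fun m _ => by ring
  have h1 : ∑ m, grad b q m * v m = q' := by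
    rw [hq'', Finset.sum_div]
    exact Finset.sum_congr rfl fun m _ => by unfold grad; ring
  have h2 : ∑ m, hess b q i m * v m = 1 / (q - b i) * (∑ m, gradAux b q m * v m)
      - (1 / (q - b i)) ^ 2 * q' / logD b q + (1 / (q - b i)) ^ 2 / logD b q * v i := by
    have : ∀ m, hess b q i m * v m = 1 / (q - b i) * (gradAux b q m * v m)
        - (1 / (q - b i)) ^ 2 / logD b q ^ 2 * (1 / (q - b m) * v m)
        + if i = m then (1 / (q - b i)) ^ 2 / logD b q * v m else 0 := by
      intro m
      unfold hess
      split_ifs <;> ring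
    simp only [this, Finset.sum_add_distrib, Finset.sum_sub_distrib, ← Finset.mul_sum,
      Finset.sum_ite_eq, Finset.mem_univ, if_true]
    rw [hq'']
    field_simp
  have h3 : ∑ m, gradAux b q m * v m = q / (1 + q ^ 2) * q' / logD b q
      - logDDot b q v q' / logD b q ^ 2 := by
    have hterm : ∀ m, gradAux b q m * v m = q / (1 + q ^ 2) / logD b q ^ 2 * (1 / (q - b m) * v m)
        - 1 / logD b q ^ 2 * ((1 / (q - b m)) ^ 2 * v m)
        - (-(∑ k, (1 / (q - b k)) ^ 2) - N * (1 - q ^ 2) / (1 + q ^ 2) ^ 2) / logD b q ^ 3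
          * (1 / (q - b m) * v m) := by
      intro m
      unfold gradAux
      generalize 1 / (q - b m) = κ
      field_simp
      ring
    have hdot : logDDot b q v q' = (-(∑ k, (1 / (q - b k)) ^ 2)
        - N * (1 - q ^ 2) / (1 + q ^ 2) ^ 2) * q' + ∑ m, (1 / (q - b m)) ^ 2 * v m := by
      unfold logDDot
      have : ∑ m, (q' - v m) / (q - b m) ^ 2
          = (∑ m, (1 / (q - b m)) ^ 2) * q' - ∑ m, (1 / (q - b m)) ^ 2 * v m := by
        rw [Finset.sum_mul, ← Finset.sum_sub_distrib]
        exact Finset.sum_congr rfl fun m _ => by rw [div_eq_mul_inv, one_div, inv_pow]; ring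
      rw [this]
      ring
    simp only [hterm, Finset.sum_sub_distrib, ← Finset.mul_sum]
    rw [hdot, hq'']
    field_simp
    ring
  rw [h1, h2, h3]
  unfold wDot grad
  generalize q - b i = y
  ring

/-- The linear equation on G(q(b)) that makes Q V symmetric in `velocity_eq`. The sums over k reduce
to power sums of 1/(q - b_k), the first being eliminated through `logD`; what remains is a rational
identity in q - b_i, q - b_j, `logD`, C⁰, q and the second power sum. -/
theorem hess_identity {b : Fin N → ℝ} {q : ℝ} (h0 : ∀ m, q - b m ≠ 0) (hP : logD b q ≠ 0)
    (i j : Fin N) :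
    ∑ k, (1 + b k ^ 2) * (hess b q j k - hess b q i k)
      = (b j * grad b q j - b i * grad b q i) - C0 b * (b j - b i) * hess b q i j := by
  by_cases hij : i = j
  · subst hij
    simp
  set K1 := ∑ k, 1 / (q - b k) with hK1
  set K2 := ∑ k, (1 / (q - b k)) ^ 2 with hK2
  have hPK : logD b q = K1 - N * q / (1 + q ^ 2) := rfl
  -- Division with remainder: 1 + b² = (1 + q²) - (q + b)(q - b).
  have hRb : ∑ k, (1 + b k ^ 2) * (1 / (q - b k)) = (1 + q ^ 2) * K1 - N * q - C0 b := by
    have : ∀ k, (1 + b k ^ 2) * (1 / (q - b k)) = (1 + q ^ 2) * (1 / (q - b k)) - q - b k := by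
      intro k
      field_simp [h0 k]
      ring
    simp only [this, Finset.sum_sub_distrib, ← Finset.mul_sum]
    simp [C0, hK1]
  have hRc : ∑ k, (1 + b k ^ 2) * (1 / (q - b k)) ^ 2 = (1 + q ^ 2) * K2 - 2 * q * K1 + N := by
    have : ∀ k, (1 + b k ^ 2) * (1 / (q - b k)) ^ 2
        = (1 + q ^ 2) * (1 / (q - b k)) ^ 2 - 2 * q * (1 / (q - b k)) + 1 := by
      intro k
      field_simp [h0 k]
      ring
    simp only [this, Finset.sum_add_distrib, Finset.sum_sub_distrib, ← Finset.mul_sum]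
    simp [hK1, hK2]
  have hlhs : ∑ k, (1 + b k ^ 2) * (hess b q j k - hess b q i k)
      = (1 / (q - b j) - 1 / (q - b i)) * (q / (1 + q ^ 2) / logD b q ^ 2
            * (∑ k, (1 + b k ^ 2) * (1 / (q - b k)))
          - 1 / logD b q ^ 2 * (∑ k, (1 + b k ^ 2) * (1 / (q - b k)) ^ 2)
          - (-K2 - N * (1 - q ^ 2) / (1 + q ^ 2) ^ 2) / logD b q ^ 3
            * (∑ k, (1 + b k ^ 2) * (1 / (q - b k))))
        - ((1 / (q - b j)) ^ 2 - (1 / (q - b i)) ^ 2) / logD b q ^ 2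
          * (∑ k, (1 + b k ^ 2) * (1 / (q - b k)))
        + ((1 + b j ^ 2) * (1 / (q - b j)) ^ 2 - (1 + b i ^ 2) * (1 / (q - b i)) ^ 2)
          / logD b q := by
    have : ∀ k, (1 + b k ^ 2) * (hess b q j k - hess b q i k)
        = (1 / (q - b j) - 1 / (q - b i)) * (q / (1 + q ^ 2) / logD b q ^ 2
            * ((1 + b k ^ 2) * (1 / (q - b k)))
          - 1 / logD b q ^ 2 * ((1 + b k ^ 2) * (1 / (q - b k)) ^ 2)
          - (-K2 - N * (1 - q ^ 2) / (1 + q ^ 2) ^ 2) / logD b q ^ 3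
            * ((1 + b k ^ 2) * (1 / (q - b k))))
        - ((1 / (q - b j)) ^ 2 - (1 / (q - b i)) ^ 2) / logD b q ^ 2
          * ((1 + b k ^ 2) * (1 / (q - b k)))
        + ((if j = k then (1 + b k ^ 2) * (1 / (q - b k)) ^ 2 / logD b q else 0)
          - (if i = k then (1 + b k ^ 2) * (1 / (q - b k)) ^ 2 / logD b q else 0)) := by
      intro k
      have e : ∀ i, (if i = k then (1 / (q - b i)) ^ 2 / logD b q else 0) * (1 + b k ^ 2)
          = if i = k then (1 + b k ^ 2) * (1 / (q - b k)) ^ 2 / logD b q else 0 := by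
        intro i
        split_ifs with h
        · rw [h]
          ring
        · ring
      rw [← e, ← e]
      unfold hess gradAux
      generalize (if j = k then (1 / (q - b j)) ^ 2 / logD b q else 0) = y1
      generalize (if i = k then (1 / (q - b i)) ^ 2 / logD b q else 0) = y2
      rw [← hK2]
      generalize 1 / (q - b j) = κj
      generalize 1 / (q - b i) = κi
      generalize 1 / (q - b k) = κk
      clear_value K2
      clear * -
      ring
    simp only [this, Finset.sum_add_distrib, Finset.sum_sub_distrib, ← Finset.mul_sum,
      Finset.sum_ite_eq, Finset.mem_univ, if_true]
    ring
  rw [hlhs, hRb, hRc]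
  have hK1' : K1 = logD b q + N * q / (1 + q ^ 2) := by rw [hPK]; ring
  rw [hK1']
  unfold hess gradAux grad
  rw [if_neg hij, ← hK2]
  have hi := h0 i
  have hj := h0 j
  have h3 := one_add_sq_ne_zero q
  obtain ⟨y, hy⟩ : ∃ y, y = q - b i := ⟨_, rfl⟩
  obtain ⟨w, hw⟩ : ∃ w, w = q - b j := ⟨_, rfl⟩
  have hbi : b i = q - y := by rw [hy]; ring
  have hbj : b j = q - w := by rw [hw]; ring
  rw [← hy] at hi
  rw [← hw] at hj
  rw [← hy, ← hw, hbi, hbj]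
  generalize logD b q = P at *
  generalize C0 b = C at *
  clear_value K2
  field_simp
  ring

open Matrix in
/-- The algebraic core: the velocity equations of a hodograph system determine `b_t`. -/
theorem velocity_eq {b : Fin N → ℝ} {θ : ℝ} {H : Fin N → Fin N → ℝ} (hC : C0 b ≠ 0)
    (hsymm : ∀ i j, H i j = H j i)
    (hH : ∀ i j, ∑ k, (1 + b k ^ 2) * (H j k - H i k)
      = θ * (b j - b i) - C0 b * (b j - b i) * H i j)
    {X T : Fin N → ℝ} (hX : ∀ i, -θ * (∑ m, X m) + C0 b * (∑ m, H i m * X m) = 1)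
    (hT : ∀ i, -θ * (∑ m, T m) + C0 b * (∑ m, H i m * T m) = 2 * C1 b - C0 b * b i)
    (hXE : ∀ i j, b i = b j → X i = X j) (hTE : ∀ i j, b i = b j → T i = T j) (k : Fin N) :
    T k = (1 + b k ^ 2) * (∑ m, X m) - C0 b * b k * X k := by
  -- With H the Hessian of the potential and θ the common value of its partial derivatives, Q is the
  -- matrix of the differentiated hodograph system; V is the velocity matrix, so that (1) reads b_t
  -- = V b_x.
  let Q : Matrix (Fin N) (Fin N) ℝ := of fun i j => C0 b * H i j - θ
  let V : Matrix (Fin N) (Fin N) ℝ := of fun i j => (1 + b i ^ 2) - if i = j then C0 b * b i else 0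
  have hQ : ∀ u i, (Q *ᵥ u) i = -θ * (∑ m, u m) + C0 b * (∑ m, H i m * u m) := by
    intro u i
    simp only [mulVec, dotProduct, Q, of_apply, sub_mul, Finset.sum_sub_distrib, Finset.mul_sum]
    rw [sub_eq_add_neg, ← Finset.sum_neg_distrib, add_comm]
    congr 1 <;> exact Finset.sum_congr rfl fun m _ => by ring
  have hV : ∀ u i, (V *ᵥ u) i = (1 + b i ^ 2) * (∑ m, u m) - C0 b * b i * u i := by
    intro u i
    simp [mulVec, dotProduct, V, sub_mul, Finset.sum_sub_distrib, Finset.mul_sum]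
  have hQs : Qᵀ = Q := by
    ext i j
    simp [Q, hsymm i j]
  -- Since Q is symmetric, this is the symmetry of Q V; entrywise it is the identity `hH` multiplied
  -- by C⁰.
  have hcomm : Q * V = Vᵀ * Q := by
    ext i j
    have hL : (Q * V) i j = C0 b * (∑ k, (1 + b k ^ 2) * H i k) - θ * (∑ k, (1 + b k ^ 2))
        - (C0 b * H i j - θ) * (C0 b * b j) := by
      simp only [mul_apply, Q, V, of_apply, mul_sub, mul_ite, mul_zero, Finset.sum_sub_distrib,
        Finset.sum_ite_eq', Finset.mem_univ, if_true, Finset.mul_sum]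
      congr 1
      rw [← Finset.sum_sub_distrib]
      exact Finset.sum_congr rfl fun m _ => by ring
    have hR : (Vᵀ * Q) i j = C0 b * (∑ k, (1 + b k ^ 2) * H j k) - θ * (∑ k, (1 + b k ^ 2))
        - (C0 b * H i j - θ) * (C0 b * b i) := by
      simp only [mul_apply, Q, V, of_apply, transpose_apply, sub_mul, ite_mul, zero_mul,
        Finset.sum_sub_distrib, Finset.sum_ite_eq', Finset.mem_univ, if_true, Finset.mul_sum]
      have : ∑ x, (1 + b x ^ 2) * (C0 b * H x j - θ)
          = ∑ x, C0 b * ((1 + b x ^ 2) * H j x) - ∑ x, θ * (1 + b x ^ 2) := by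
        rw [← Finset.sum_sub_distrib]
        exact Finset.sum_congr rfl fun m _ => by rw [hsymm m j]; ring
      rw [this]
      ring
    have := hH i j
    simp only [mul_sub, Finset.sum_sub_distrib] at this
    rw [hL, hR]
    linear_combination (-C0 b) * this
  have hQX : Q *ᵥ X = fun _ => 1 := by
    funext i
    rw [hQ, hX]
  -- The column sums of V are ∑ (1 + b_k²) - C⁰ b_i = 2C¹ - C⁰ b_i, exactly the right-hand side for
  -- T.
  have hQT : Q *ᵥ T = Vᵀ *ᵥ (Q *ᵥ X) := by
    funext i
    rw [hQX, hQ, hT]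
    simp only [mulVec, dotProduct, V, transpose_apply, of_apply, mul_one, Finset.sum_sub_distrib,
      Finset.sum_ite_eq', Finset.mem_univ, if_true, C1, Finset.sum_add_distrib]
    simp
    ring
  -- Q may be singular, so T = V X is obtained by showing that this part of its kernel, which
  -- contains T - V X, is zero.
  let K : Set (Fin N → ℝ) := {u | Q *ᵥ u = 0 ∧ ∀ i j, b i = b j → u i = u j}
  -- Pair u with Q X = (1,…,1) and use the symmetry of Q.
  have hsum : ∀ u ∈ K, ∑ m, u m = 0 := by
    intro u hu
    have h1 : (Q *ᵥ X) ⬝ᵥ u = 0 := by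
      have h2 : Q *ᵥ X = X ᵥ* Q := by
        conv_lhs => rw [← hQs]
        exact mulVec_transpose _ _
      rw [h2, ← dotProduct_mulVec, hu.1, dotProduct_zero]
    rw [hQX] at h1
    simpa [dotProduct] using h1
  -- Because ∑ u = 0, V acts on K as multiplication by -C⁰ b_i, and Q V = Vᵀ Q keeps the image in
  -- the kernel. As C⁰ ≠ 0, K is stable under multiplication by any polynomial in b.
  have hmul : ∀ u ∈ K, ∀ r : ℝ, (fun i => (b i - r) * u i) ∈ K := by
    intro u hu r
    refine ⟨?_, fun i j hij => by simp only [hij, hu.2 i j hij]⟩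
    have hVu : V *ᵥ u = fun i => -C0 b * (b i * u i) := by
      funext i
      rw [hV, hsum u hu]
      ring
    have h1 : Q *ᵥ (V *ᵥ u) = 0 := by
      rw [mulVec_mulVec, hcomm, ← mulVec_mulVec, hu.1, mulVec_zero]
    have h2 : (fun i => (b i - r) * u i) = (-(C0 b)⁻¹) • (V *ᵥ u) + (-r) • u := by
      funext i
      simp only [hVu, Pi.add_apply, Pi.smul_apply, smul_eq_mul]
      field_simp
      ring
    rw [h2, mulVec_add, mulVec_smul, mulVec_smul, h1, hu.1]
    simp
  have hprod : ∀ u ∈ K, ∀ S : Finset ℝ, (fun i => (∏ r ∈ S, (b i - r)) * u i) ∈ K := by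
    intro u hu S
    induction S using Finset.induction_on with
    | empty => simpa using hu
    | insert r S hr ih =>
      have := hmul _ ih r
      simpa [Finset.prod_insert hr, mul_assoc] using this
  -- Lagrange interpolation: a polynomial vanishing at every value except b_k isolates the group of
  -- b_k. The sum rule then reads (size of the group) · p · u_k = 0.
  have hzero : ∀ u ∈ K, u = 0 := by
    intro u hu
    funext k
    have h1 := hsum _ (hprod u hu ((Finset.univ.image b).erase (b k)))
    set p : ℝ := ∏ r ∈ (Finset.univ.image b).erase (b k), (b k - r)
    have hp : p ≠ 0 := by
      refine Finset.prod_ne_zero_iff.2 fun r hr => sub_ne_zero.2 ?_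
      exact (Finset.ne_of_mem_erase hr).symm
    have h2 : ∀ m, (∏ r ∈ (Finset.univ.image b).erase (b k), (b m - r)) * u m
        = if b m = b k then p * u k else 0 := by
      intro m
      split_ifs with h
      · rw [h, hu.2 m k h]
      · rw [Finset.prod_eq_zero (i := b m) (Finset.mem_erase.2 ⟨h, Finset.mem_image_of_mem _
          (Finset.mem_univ _)⟩) (sub_self _), zero_mul]
    simp only [h2, ← Finset.sum_filter, Finset.sum_const, nsmul_eq_mul] at h1
    have hcard : ((Finset.univ.filter fun m => b m = b k).card : ℝ) ≠ 0 := by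
      rw [Nat.cast_ne_zero]
      exact Finset.card_ne_zero_of_mem (a := k) (by simp)
    simpa [hcard, hp] using h1
  have hu : T - V *ᵥ X ∈ K := by
    refine ⟨?_, fun i j hij => ?_⟩
    · rw [mulVec_sub, hQT, mulVec_mulVec, mulVec_mulVec, hcomm, sub_self]
    · simp only [Pi.sub_apply, hV, hij, hTE i j hij, hXE i j hij]
  have := congrFun (hzero _ hu) k
  simp only [Pi.sub_apply, hV, Pi.zero_apply] at this
  linarith

end GeodHydro

/-! ### Inverse branches, and the passage from the hodograph system to (1). -/

namespace GeodHydro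

open Filter Topology

variable {N : ℕ}

theorem contDiff_surface : ContDiff ℝ ω (fun y : (Fin N → ℝ) × ℝ => surface y.1 y.2) := by
  unfold surface
  refine ContDiff.mul (contDiff_iff_contDiffAt.2 fun y => ?_) (contDiff_prod fun m _ => ?_)
  · refine ContDiffAt.rpow_const_of_ne ?_ (one_add_sq_ne_zero y.2)
    exact contDiffAt_const.add (contDiffAt_snd.pow 2)
  · exact contDiff_snd.sub ((contDiff_apply ℝ ℝ m).comp contDiff_fst)

theorem hasDerivAt_line {P E F : Type*} [NormedAddCommGroup P] [NormedSpace ℝ P]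
    [NormedAddCommGroup E] [NormedSpace ℝ E] [NormedAddCommGroup F] [NormedSpace ℝ F]
    {f : P × E → F} {p : P} {e : E} (hf : DifferentiableAt ℝ f (p, e)) (u : E) :
    HasDerivAt (fun r : ℝ => f (p, e + r • u)) (fderiv ℝ f (p, e) (0, u)) 0 := by
  have h1 : HasDerivAt (fun r : ℝ => (p, e + r • u)) ((0 : P), u) 0 := by
    refine (hasDerivAt_const (0 : ℝ) p).prodMk ?_
    simpa using ((hasDerivAt_id (0 : ℝ)).smul_const u).const_add e
  have h2 : HasFDerivAt f (fderiv ℝ f (p, e)) (p, e + (0 : ℝ) • u) := by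
    simpa using hf.hasFDerivAt
  exact h2.comp_hasDerivAt (0 : ℝ) h1

theorem fderiv_surface (b : Fin N → ℝ) (q : ℝ) :
    fderiv ℝ (fun y : (Fin N → ℝ) × ℝ => surface y.1 y.2) (b, q) (0, 1) = deriv (surface b) q := by
  have hd : DifferentiableAt ℝ (fun y : (Fin N → ℝ) × ℝ => surface y.1 y.2) (b, q) :=
    contDiff_surface.contDiffAt.differentiableAt (by simp)
  have h1 : HasDerivAt (fun r : ℝ => (b, r)) ((0 : Fin N → ℝ), (1 : ℝ)) q :=
    (hasDerivAt_const q b).prodMk (hasDerivAt_id q)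
  have h := hd.hasFDerivAt.comp_hasDerivAt q h1
  exact h.deriv.symm

theorem continuous_deriv_surface :
    Continuous (fun y : (Fin N → ℝ) × ℝ => deriv (surface y.1) y.2) := by
  have h := (contDiff_surface (N := N)).continuous_fderiv (by simp)
  have h2 := h.clm_apply (continuous_const (y := ((0 : Fin N → ℝ), (1 : ℝ))))
  refine h2.congr fun y => ?_
  exact fderiv_surface y.1 y.2

/-- Local analytic branches of the inverse function, jointly in the parameter and in `b`. -/
theorem exists_branch {b₀ : Fin N → ℝ} {q₀ l₀ : ℝ} (hs : surface b₀ q₀ = l₀)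
    (hd : deriv (surface b₀) q₀ ≠ 0) :
    ∃ (A : Set ℝ) (B : Set (Fin N → ℝ)) (V : Set ℝ) (q : ℝ × (Fin N → ℝ) → ℝ),
      IsOpen A ∧ IsOpen B ∧ IsOpen V ∧ l₀ ∈ A ∧ b₀ ∈ B ∧ q₀ ∈ V ∧ ContDiffOn ℝ ω q (A ×ˢ B) ∧
      (∀ l ∈ A, ∀ b ∈ B, q (l, b) ∈ V ∧ deriv (surface b) (q (l, b)) ≠ 0) ∧
      ∀ l ∈ A, ∀ b ∈ B, ∀ e ∈ V, surface b e = l ↔ e = q (l, b) := by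
  let f : (ℝ × (Fin N → ℝ)) × ℝ → ℝ := fun y => surface y.1.2 y.2 - y.1.1
  have hf : ContDiff ℝ ω f :=
    (contDiff_surface.comp ((contDiff_snd.comp contDiff_fst).prodMk contDiff_snd)).sub
      (contDiff_fst.comp contDiff_fst)
  have hker : ∀ u, fderiv ℝ f ((l₀, b₀), q₀) (0, u) = 0 → u = 0 := by
    intro u hu
    have h1 := hasDerivAt_line (hf.contDiffAt.differentiableAt (by simp) :
      DifferentiableAt ℝ f ((l₀, b₀), q₀)) u
    have h2 : HasDerivAt (surface b₀) (deriv (surface b₀) q₀) (q₀ + (0 : ℝ) • u) := by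
      have : DifferentiableAt ℝ (surface b₀) q₀ := by
        by_contra h
        exact hd (deriv_zero_of_not_differentiableAt h)
      simpa using this.hasDerivAt
    have h3 : HasDerivAt (fun r : ℝ => q₀ + r • u) u 0 := by
      simpa using ((hasDerivAt_id (0 : ℝ)).smul_const u).const_add q₀
    have h4 := (h2.comp (0 : ℝ) h3).sub_const l₀
    have h5 := h1.unique h4
    rw [hu] at h5
    exact (mul_eq_zero.1 h5.symm).resolve_left hd
  have hO : {y : (ℝ × (Fin N → ℝ)) × ℝ | deriv (surface y.1.2) y.2 ≠ 0} ∈ 𝓝 ((l₀, b₀), q₀) := by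
    refine (IsOpen.preimage (f := fun y : (ℝ × (Fin N → ℝ)) × ℝ => deriv (surface y.1.2) y.2) ?_
      isOpen_ne).mem_nhds hd
    exact continuous_deriv_surface.comp
      ((continuous_snd.comp continuous_fst).prodMk continuous_snd)
  obtain ⟨AB, V, q, hAB, hV, hmem, hqV, hq, hsub, hmaps, hiff⟩ :=
    exists_implicit_family hf.contDiffAt (by simp [f, hs]) hker hO
  obtain ⟨A, B, hA, hlA, hB, hbB, hABs⟩ := mem_nhds_prod_iff'.1 (hAB.mem_nhds hmem)
  refine ⟨A, B, V, q, hA, hB, hV, hlA, hbB, hqV, hq.mono hABs, fun l hl b hb => ?_,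
    fun l hl b hb e he => ?_⟩
  · have h1 := hmaps _ (hABs (Set.mk_mem_prod hl hb))
    exact ⟨h1, hsub (Set.mk_mem_prod (hABs (Set.mk_mem_prod hl hb)) h1)⟩
  · rw [← hiff (l, b) (hABs (Set.mk_mem_prod hl hb)) e he, sub_eq_zero]

/-- Continuity suffices: by local uniqueness in the implicit function theorem the branch coincides
with the analytic one nearby. -/
theorem IsInverseBranch.contDiffAt {l : ℝ} {Ω : Set (Fin N → ℝ)} {q : (Fin N → ℝ) → ℝ}
    (h : IsInverseBranch l Ω q) {b : Fin N → ℝ} (hb : b ∈ Ω) : ContDiffAt ℝ ω q b := by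
  obtain ⟨A, B, V, Q, hA, hB, hV, hlA, hbB, hqV, hQ, -, hiff⟩ :=
    exists_branch (h.surface_eq b hb) (h.deriv_ne_zero b hb)
  have hQb : ContDiffAt ℝ ω (fun b => Q (l, b)) b :=
    (hQ.contDiffAt ((hA.prod hB).mem_nhds (Set.mk_mem_prod hlA hbB))).comp b
      (contDiffAt_const.prodMk contDiffAt_id)
  refine hQb.congr_of_eventuallyEq ?_
  have hc := h.continuousOn.continuousAt (h.isOpen.mem_nhds hb)
  filter_upwards [h.isOpen.mem_nhds hb, hB.mem_nhds hbB, hc.preimage_mem_nhds (hV.mem_nhds hqV)]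
    with b' h1 h2 h3
  exact (hiff l hlA b' h2 _ h3).1 (h.surface_eq b' h1)

theorem IsInverseBranch.logD_ne_zero {l : ℝ} (hl : l ≠ 0) {Ω : Set (Fin N → ℝ)}
    {q : (Fin N → ℝ) → ℝ} (h : IsInverseBranch l Ω q) {b : Fin N → ℝ} (hb : b ∈ Ω) :
    logD b (q b) ≠ 0 := by
  intro h0
  have hd := h.deriv_ne_zero b hb
  rw [deriv_surface (sub_ne_zero_of_surface_ne_zero ((h.surface_eq b hb).trans_ne hl)), h0,
    mul_zero] at hd
  exact hd rfl

/-- Choose a point of O with the largest number of pairs b_i ≠ b_j. Inequalities persist nearby, so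
by maximality no new one can appear. -/
theorem exists_locally_constant_pattern {X : Type*} [TopologicalSpace X] {b : X → Fin N → ℝ}
    {O : Set X} (hO : IsOpen O) (hne : O.Nonempty) (hb : ContinuousOn b O) :
    ∃ z ∈ O, ∀ i j, b z i = b z j → ∀ᶠ y in 𝓝 z, b y i = b y j := by
  let D : X → Finset (Fin N × Fin N) := fun z => Finset.univ.filter fun p => b z p.1 ≠ b z p.2
  let S : Set ℕ := (fun z => (D z).card) '' O
  have hS : BddAbove S := ⟨Fintype.card (Fin N × Fin N), by
    rintro _ ⟨z, -, rfl⟩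
    exact Finset.card_le_univ _⟩
  obtain ⟨z, hz, hmax⟩ := Nat.sSup_mem (hne.image _) hS
  refine ⟨z, hz, fun i j hij => ?_⟩
  have hbz : ContinuousAt b z := hb.continuousAt (hO.mem_nhds hz)
  have hsub : ∀ᶠ y in 𝓝 z, D z ⊆ D y := by
    have : ∀ p ∈ D z, ∀ᶠ y in 𝓝 z, p ∈ D y := by
      intro p hp
      have hp' : b z p.1 ≠ b z p.2 := by simpa [D] using hp
      have h1 : ContinuousAt (fun y => b y p.1) z := (continuous_apply p.1).continuousAt.comp hbz
      have h2 : ContinuousAt (fun y => b y p.2) z := (continuous_apply p.2).continuousAt.comp hbz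
      filter_upwards [(h1.ne_iff_eventually_ne h2).1 hp'] with y hy
      exact Finset.mem_filter.2 ⟨Finset.mem_univ _, hy⟩
    exact ((D z).eventually_all.2 this).mono fun y hy p hp => hy p hp
  filter_upwards [hsub, hO.mem_nhds hz] with y hy hyO
  by_contra hne'
  have hle : (D y).card ≤ (D z).card := by
    refine (le_csSup hS ?_).trans hmax.ge
    exact ⟨y, hyO, rfl⟩
  have heq := Finset.eq_of_subset_of_card_le hy hle
  have : (i, j) ∈ D z := by
    rw [heq]
    simpa [D] using hne'
  simp [D, hij] at this

/-- The velocity relations satisfied along a direction by a solution of a hodograph system. -/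
theorem velocity_relation {M : ℕ} {l σ : Fin M → ℝ} {Ω : Set (Fin N → ℝ)}
    {q : Fin M → (Fin N → ℝ) → ℝ} {U : Set (ℝ × ℝ)} {b : ℝ × ℝ → Fin N → ℝ}
    (hq : ∀ j, l j ≠ 0 ∧ IsInverseBranch (l j) Ω (q j)) (hU : IsOpen U) (hb : ContDiffOn ℝ 1 b U)
    (h : ∀ z ∈ U, b z ∈ Ω ∧ C0 (b z) ≠ 0 ∧ SuperHodograph z.1 z.2 (b z) σ (fun j => q j (b z)))
    {z : ℝ × ℝ} (hz : z ∈ U) (e : ℝ × ℝ) (i : Fin N) :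
    ∑ j, σ j * (√(1 + q j (b z) ^ 2) *
        (-2 * (∑ m, grad (b z) (q j (b z)) m * fderiv ℝ (fun y => b y m) z e)
          + (∑ m, fderiv ℝ (fun y => b y m) z e) * grad (b z) (q j (b z)) i
          + C0 (b z) * ∑ m, hess (b z) (q j (b z)) i m * fderiv ℝ (fun y => b y m) z e))
      = e.1 + e.2 * (2 * C1 (b z) - C0 (b z) * b z i)
        + z.2 * (2 * (∑ m, b z m * fderiv ℝ (fun y => b y m) z e)
          - (∑ m, fderiv ℝ (fun y => b y m) z e) * b z i
          - C0 (b z) * fderiv ℝ (fun y => b y i) z e) := by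
  set v : Fin N → ℝ := fun m => fderiv ℝ (fun y => b y m) z e with hv
  have hline : HasDerivAt (fun r : ℝ => z + r • e) e 0 := by
    simpa using ((hasDerivAt_id (0 : ℝ)).smul_const e).const_add z
  have hz0 : z + (0 : ℝ) • e = z := by simp
  have hbm : ∀ m, DifferentiableAt ℝ (fun y => b y m) z := fun m =>
    (((contDiffOn_pi.1 hb) m).contDiffAt (hU.mem_nhds hz)).differentiableAt (by simp)
  have hc : HasDerivAt (fun r : ℝ => b (z + r • e)) v 0 := by
    refine hasDerivAt_pi.2 fun m => ?_
    have h1 : HasFDerivAt (fun y => b y m) (fderiv ℝ (fun y => b y m) z) (z + (0 : ℝ) • e) := by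
      rw [hz0]
      exact (hbm m).hasFDerivAt
    exact h1.comp_hasDerivAt (0 : ℝ) hline
  have hevU : ∀ᶠ r : ℝ in 𝓝 0, z + r • e ∈ U :=
    hline.continuousAt.preimage_mem_nhds (by rw [hz0]; exact hU.mem_nhds hz)
  obtain ⟨hzΩ, -, -⟩ := h z hz
  have hqd : ∀ j, HasDerivAt (fun r : ℝ => q j (b (z + r • e))) (fderiv ℝ (q j) (b z) v) 0 := by
    intro j
    have h1 : HasFDerivAt (q j) (fderiv ℝ (q j) (b z)) (b (z + (0 : ℝ) • e)) := by
      rw [hz0]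
      exact (((hq j).2.contDiffAt hzΩ).differentiableAt (by simp)).hasFDerivAt
    exact h1.comp_hasDerivAt (0 : ℝ) hc
  have h0 : ∀ j m, q j (b z) - b z m ≠ 0 := fun j =>
    sub_ne_zero_of_surface_ne_zero (((hq j).2.surface_eq _ hzΩ).trans_ne (hq j).1)
  have hP : ∀ j, logD (b z) (q j (b z)) ≠ 0 := fun j => (hq j).2.logD_ne_zero (hq j).1 hzΩ
  have hspeed : ∀ j, logD (b z) (q j (b z)) * fderiv ℝ (q j) (b z) v
      = ∑ m, v m / (q j (b z) - b z m) := by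
    intro j
    have := speed_eq hc (hqd j) (hasDerivAt_const (0 : ℝ) (l j))
      (hevU.mono fun r hr => (hq j).2.surface_eq _ (h _ hr).1) (hq j).1
    simpa using this
  have hR := HasDerivAt.fun_sum (u := Finset.univ) fun j _ =>
    (hasDerivAt_W hc (hqd j) (by simpa using h0 j) (by simpa using hP j) i).const_mul (σ j)
  have hx : HasDerivAt (fun r : ℝ => (z + r • e).1) e.1 0 := by
    simpa using ((hasDerivAt_id (0 : ℝ)).mul_const e.1).const_add z.1
  have ht : HasDerivAt (fun r : ℝ => (z + r • e).2) e.2 0 := by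
    simpa using ((hasDerivAt_id (0 : ℝ)).mul_const e.2).const_add z.2
  have hL := hasDerivAt_hodographLHS hc hx ht i
  have heq := (hL.congr_of_eventuallyEq (hevU.mono fun r hr => ((h _ hr).2.2 i).symm)).unique hR
  simp only [hz0] at heq
  rw [heq]
  refine Finset.sum_congr rfl fun j _ => ?_
  rw [wDot_eq (hP j) (hspeed j)]

theorem solvesSystem_of_superHodograph {M : ℕ} {l σ : Fin M → ℝ} {Ω : Set (Fin N → ℝ)}
    {q : Fin M → (Fin N → ℝ) → ℝ} {U : Set (ℝ × ℝ)} {b : ℝ × ℝ → Fin N → ℝ}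
    (hq : ∀ j, l j ≠ 0 ∧ IsInverseBranch (l j) Ω (q j)) (hU : IsOpen U) (hb : ContDiffOn ℝ 1 b U)
    (h : ∀ z ∈ U, b z ∈ Ω ∧ C0 (b z) ≠ 0 ∧
      SuperHodograph z.1 z.2 (b z) σ (fun j => q j (b z))) :
    SolvesSystem U b := by
  -- System (1) at points where coinciding components coincide nearby; their derivatives then agree,
  -- as `velocity_eq` requires.
  have key : ∀ z ∈ U, (∀ i j, b z i = b z j → ∀ᶠ y in 𝓝 z, b y i = b y j) → ∀ k,
      dt (fun y => b y k) z = (1 + b z k ^ 2) * ∑ m, dx (fun y => b y m) z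
        - (∑ n, b z n) * b z k * dx (fun y => b y k) z := by
    intro z hz hpat k
    obtain ⟨hzΩ, hC, hH⟩ := h z hz
    have h0 : ∀ j m, q j (b z) - b z m ≠ 0 := fun j =>
      sub_ne_zero_of_surface_ne_zero (((hq j).2.surface_eq _ hzΩ).trans_ne (hq j).1)
    have hP : ∀ j, logD (b z) (q j (b z)) ≠ 0 := fun j => (hq j).2.logD_ne_zero (hq j).1 hzΩ
    -- θ = (x + 2Φ)/C⁰; by the hodograph system every ∂_i Φ equals it, which is `hgrad`.
    set θ : ℝ := (z.1 + 2 * z.2 * C1 (b z) - ∑ j, σ j * primA (q j (b z))) / C0 (b z) with hθ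
    let w : Fin M → ℝ := fun j => σ j * √(1 + q j (b z) ^ 2)
    have hgrad : ∀ i, (∑ j, w j * grad (b z) (q j (b z)) i) + z.2 * b z i = θ := by
      intro i
      rw [hθ, eq_div_iff hC]
      have h1 := hH i
      have h2 : ∀ j, σ j * W (b z) (q j (b z)) i = σ j * primA (q j (b z))
          + C0 (b z) * (w j * grad (b z) (q j (b z)) i) := by
        intro j
        simp only [w, W, grad, primA, logD]
        ring
      simp only [h2, Finset.sum_add_distrib, ← Finset.mul_sum] at h1
      linear_combination (-1 : ℝ) * h1
    -- The Hessian of Φ; the term t C¹ contributes t times the identity.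
    let H : Fin N → Fin N → ℝ := fun i m =>
      (∑ j, w j * hess (b z) (q j (b z)) i m) + if i = m then z.2 else 0
    have hrel : ∀ (e : ℝ × ℝ) (i : Fin N), -θ * (∑ m, fderiv ℝ (fun y => b y m) z e)
        + C0 (b z) * (∑ m, H i m * fderiv ℝ (fun y => b y m) z e)
        = e.1 + e.2 * (2 * C1 (b z) - C0 (b z) * b z i) := by
      intro e i
      have h1 := velocity_relation hq hU hb h hz e i
      set v : Fin N → ℝ := fun m => fderiv ℝ (fun y => b y m) z e with hv
      have h2 : ∑ m, H i m * v m
          = (∑ j, w j * ∑ m, hess (b z) (q j (b z)) i m * v m) + z.2 * v i := by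
        simp only [H, add_mul, Finset.sum_add_distrib, ite_mul, zero_mul, Finset.sum_ite_eq,
          Finset.mem_univ, if_true, Finset.sum_mul, Finset.mul_sum]
        congr 1
        rw [Finset.sum_comm]
        exact Finset.sum_congr rfl fun j _ => Finset.sum_congr rfl fun m _ => by ring
      have h3 : θ * ∑ m, v m = (∑ j, w j * ∑ m, grad (b z) (q j (b z)) m * v m)
          + z.2 * ∑ m, b z m * v m := by
        rw [Finset.mul_sum]
        have : ∀ m, θ * v m = (∑ j, w j * (grad (b z) (q j (b z)) m * v m))
            + z.2 * (b z m * v m) := by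
          intro m
          rw [← hgrad m, add_mul, Finset.sum_mul]
          congr 1
          · exact Finset.sum_congr rfl fun j _ => by ring
          · ring
        simp only [this, Finset.sum_add_distrib, ← Finset.mul_sum]
        congr 1
        rw [Finset.sum_comm]
        simp only [Finset.mul_sum]
      have h4 : ∑ j, σ j * (√(1 + q j (b z) ^ 2) * (-2 * (∑ m, grad (b z) (q j (b z)) m * v m)
            + (∑ m, v m) * grad (b z) (q j (b z)) i
            + C0 (b z) * ∑ m, hess (b z) (q j (b z)) i m * v m))
          = -2 * (∑ j, w j * ∑ m, grad (b z) (q j (b z)) m * v m)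
            + (∑ m, v m) * (∑ j, w j * grad (b z) (q j (b z)) i)
            + C0 (b z) * ∑ j, w j * ∑ m, hess (b z) (q j (b z)) i m * v m := by
        rw [Finset.mul_sum (a := -2), Finset.mul_sum (a := ∑ m, v m),
          Finset.mul_sum (a := C0 (b z)), ← Finset.sum_add_distrib, ← Finset.sum_add_distrib]
        exact Finset.sum_congr rfl fun j _ => by simp only [w]; ring
      rw [h4] at h1
      rw [h2]
      -- Both gradient terms collapse because ∂_i Φ = θ: θ ∑ v - 2θ ∑ v = -θ ∑ v.
      linear_combination h1 - 2 * h3 - (∑ m, v m) * hgrad i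
    have hsymm : ∀ i j, H i j = H j i := by
      intro i j
      simp only [H, hess_symm (b z) _ i j, eq_comm (a := i)]
    have hHid : ∀ i j, ∑ k, (1 + b z k ^ 2) * (H j k - H i k)
        = θ * (b z j - b z i) - C0 (b z) * (b z j - b z i) * H i j := by
      intro i j
      have h1 : ∀ k, (1 + b z k ^ 2) * (H j k - H i k)
          = (∑ s, w s * ((1 + b z k ^ 2) *
              (hess (b z) (q s (b z)) j k - hess (b z) (q s (b z)) i k)))
            + ((if j = k then z.2 * (1 + b z k ^ 2) else 0)
              - if i = k then z.2 * (1 + b z k ^ 2) else 0) := by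
        intro k
        have e : ∀ i, (if i = k then z.2 * (1 + b z k ^ 2) else 0)
            = (if i = k then z.2 else 0) * (1 + b z k ^ 2) := fun i => by split_ifs <;> ring
        rw [e, e]
        have : ∑ s, w s * ((1 + b z k ^ 2) *
              (hess (b z) (q s (b z)) j k - hess (b z) (q s (b z)) i k))
            = (1 + b z k ^ 2) * ((∑ s, w s * hess (b z) (q s (b z)) j k)
              - ∑ s, w s * hess (b z) (q s (b z)) i k) := by
          rw [← Finset.sum_sub_distrib, Finset.mul_sum]
          exact Finset.sum_congr rfl fun s _ => by ring
        rw [this]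
        simp only [H]
        ring
      simp only [h1, Finset.sum_add_distrib, Finset.sum_sub_distrib, Finset.sum_ite_eq,
        Finset.mem_univ, if_true]
      rw [Finset.sum_comm]
      simp only [← Finset.mul_sum]
      have h2 : ∀ s, w s * ∑ k, (1 + b z k ^ 2) *
            (hess (b z) (q s (b z)) j k - hess (b z) (q s (b z)) i k)
          = b z j * (w s * grad (b z) (q s (b z)) j) - b z i * (w s * grad (b z) (q s (b z)) i)
            - C0 (b z) * (b z j - b z i) * (w s * hess (b z) (q s (b z)) i j) := by
        intro s
        rw [hess_identity (h0 s) (hP s) i j]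
        ring
      simp only [h2, Finset.sum_sub_distrib, ← Finset.mul_sum]
      have hδ : (b z j - b z i) * (if i = j then z.2 else 0) = 0 := by
        split_ifs with hij
        · rw [hij, sub_self, zero_mul]
        · rw [mul_zero]
      simp only [H]
      linear_combination b z j * hgrad j - b z i * hgrad i + C0 (b z) * hδ
    have hpat' : ∀ (e : ℝ × ℝ) (i j : Fin N), b z i = b z j →
        fderiv ℝ (fun y => b y i) z e = fderiv ℝ (fun y => b y j) z e := by
      intro e i j hij
      have h1 : (fun y => b y i) =ᶠ[𝓝 z] (fun y => b y j) := hpat i j hij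
      rw [h1.fderiv_eq]
    have := velocity_eq hC hsymm hHid (X := fun m => dx (fun y => b y m) z)
      (T := fun m => dt (fun y => b y m) z)
      (fun i => by simpa [dx] using hrel (1, 0) i) (fun i => by simpa [dt] using hrel (0, 1) i)
      (hpat' (1, 0)) (hpat' (0, 1)) k
    exact this
  refine ⟨hb, fun z hz k => ?_⟩
  -- A failure would persist on an open set by continuity of the first derivatives, and that set
  -- contains a point with locally constant pattern, contradicting `key`.
  by_contra hne
  have hfd : ∀ m (e : ℝ × ℝ), ContinuousAt (fun z => fderiv ℝ (fun y => b y m) z e) z := by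
    intro m e
    have h1 := ((contDiffOn_pi.1 hb) m).continuousOn_fderiv_of_isOpen hU le_rfl
    exact (h1.continuousAt (hU.mem_nhds hz)).clm_apply continuousAt_const
  have hbc : ∀ m, ContinuousAt (fun z => b z m) z := fun m =>
    ((contDiffOn_pi.1 hb) m).continuousOn.continuousAt (hU.mem_nhds hz)
  have hR : ContinuousAt (fun z => (1 + b z k ^ 2) * ∑ m, dx (fun y => b y m) z
        - (∑ n, b z n) * b z k * dx (fun y => b y k) z) z := by
    have hs1 : ContinuousAt (fun z => ∑ m, dx (fun y => b y m) z) z :=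
      tendsto_finsetSum _ fun m _ => hfd m (1, 0)
    have hs2 : ContinuousAt (fun z => ∑ m, b z m) z := tendsto_finsetSum _ fun m _ => hbc m
    exact ((continuousAt_const.add ((hbc k).pow 2)).mul hs1).sub
      ((hs2.mul (hbc k)).mul (hfd k (1, 0)))
  have hL : ContinuousAt (fun z => dt (fun y => b y k) z) z := hfd k (0, 1)
  have hev := (hL.ne_iff_eventually_ne hR).1 hne
  obtain ⟨O, hOsub, hO, hzO⟩ := mem_nhds_iff.1 (hev.and (hU.mem_nhds hz))
  obtain ⟨y, hyO, hy⟩ := exists_locally_constant_pattern hO ⟨z, hzO⟩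
    (hb.continuousOn.mono fun y hy => (hOsub hy).2)
  exact (hOsub hyO).1 (key y (hOsub hyO).2 hy k)

theorem superHodograph_conclusions {M : ℕ} (hN : 1 ≤ N) {l σ : Fin M → ℝ} {Ω : Set (Fin N → ℝ)}
    {q : Fin M → (Fin N → ℝ) → ℝ} {U : Set (ℝ × ℝ)} {b : ℝ × ℝ → Fin N → ℝ}
    (hq : ∀ j, l j ≠ 0 ∧ IsInverseBranch (l j) Ω (q j)) (hU : IsOpen U) (hb : ContDiffOn ℝ 1 b U)
    (h : ∀ z ∈ U, b z ∈ Ω ∧ C0 (b z) ≠ 0 ∧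
      SuperHodograph z.1 z.2 (b z) σ (fun j => q j (b z))) :
    SolvesSystem U b ∧ HasPolynomialIntegral U b := by
  have hs := solvesSystem_of_superHodograph hq hU hb h
  exact ⟨hs, hs.hasPolynomialIntegral hN hU fun z hz => (h z hz).2.1⟩

theorem hodograph_conclusions (hN : 1 ≤ N) {l : ℝ} {Ω : Set (Fin N → ℝ)}
    {q : (Fin N → ℝ) → ℝ} {U : Set (ℝ × ℝ)} {b : ℝ × ℝ → Fin N → ℝ} (hl : l ≠ 0)
    (hq : IsInverseBranch l Ω q) (hU : IsOpen U) (hb : ContDiffOn ℝ 1 b U)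
    (h : ∀ z ∈ U, b z ∈ Ω ∧ C0 (b z) ≠ 0 ∧ Hodograph z.1 z.2 (b z) (q (b z))) :
    SolvesSystem U b ∧ HasPolynomialIntegral U b := by
  refine superHodograph_conclusions (M := 1) (σ := fun _ => 1) (l := fun _ => l)
    (q := fun _ => q) hN (fun _ => ⟨hl, hq⟩) hU hb fun z hz => ?_
  obtain ⟨h1, h2, h3⟩ := h z hz
  exact ⟨h1, h2, fun i => by simpa using h3 i⟩

end GeodHydro

/-! ### Regularization of W at parameter value 0. -/

namespace GeodHydro

open Filter Topology

variable {N : ℕ}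

theorem contDiff_sqrt_one_add_sq : ContDiff ℝ ω (fun q : ℝ => √(1 + q ^ 2)) :=
  (contDiff_const.add (contDiff_id.pow 2)).sqrt fun q => one_add_sq_ne_zero q

theorem contDiff_primA : ContDiff ℝ ω primA := by
  unfold primA
  exact ((contDiff_sqrt_one_add_sq.sub contDiff_id).log
    fun q => (sqrt_one_add_sq_sub_pos q).ne').sub (contDiff_id.mul contDiff_sqrt_one_add_sq)

theorem contDiff_C0 : ContDiff ℝ ω (C0 : (Fin N → ℝ) → ℝ) := by
  unfold C0
  exact ContDiff.sum fun m _ => contDiff_apply ℝ ℝ m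

theorem contDiff_C1 : ContDiff ℝ ω (C1 : (Fin N → ℝ) → ℝ) := by
  unfold C1
  exact (contDiff_const.mul (ContDiff.sum fun m _ => (contDiff_apply ℝ ℝ m).pow 2)).add
    contDiff_const

/-- The function `W` written through the derivatives of a branch `Q(l, b)`; unlike `W` it stays
regular at `l = 0`. -/
noncomputable def regW (Q : ℝ × (Fin N → ℝ) → ℝ) (y : ℝ × (Fin N → ℝ)) (i : Fin N) : ℝ :=
  primA (Q y) + C0 y.2 * (√(1 + Q y ^ 2) * fderiv ℝ Q y (0, Pi.single i 1))

theorem contDiffAt_regW {Q : ℝ × (Fin N → ℝ) → ℝ} {y : ℝ × (Fin N → ℝ)}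
    (hQ : ContDiffAt ℝ ω Q y) (i : Fin N) : ContDiffAt ℝ ω (fun y => regW Q y i) y := by
  unfold regW
  refine (contDiff_primA.contDiffAt.comp y hQ).add ((contDiff_C0.contDiffAt.comp y
    contDiffAt_snd).mul ((contDiff_sqrt_one_add_sq.contDiffAt.comp y hQ).mul ?_))
  exact (hQ.fderiv_right (m := ω) (by simp)).clm_apply contDiffAt_const

/-- Implicit differentiation gives ∂_i q = 1/((q - b_i) `logD`); it divides by λ, which is why l ≠ 0
is required here. -/
theorem regW_eq {Q : ℝ × (Fin N → ℝ) → ℝ} {A : Set ℝ} {B : Set (Fin N → ℝ)} (hA : IsOpen A)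
    (hB : IsOpen B) (hQ : ContDiffOn ℝ ω Q (A ×ˢ B))
    (hs : ∀ l ∈ A, ∀ b ∈ B, surface b (Q (l, b)) = l)
    (hd : ∀ l ∈ A, ∀ b ∈ B, deriv (surface b) (Q (l, b)) ≠ 0)
    {l : ℝ} (hl : l ∈ A) (hl0 : l ≠ 0) {b : Fin N → ℝ} (hb : b ∈ B) (i : Fin N) :
    regW Q (l, b) i = W b (Q (l, b)) i := by
  have hQd : DifferentiableAt ℝ Q (l, b) :=
    (hQ.contDiffAt ((hA.prod hB).mem_nhds (Set.mk_mem_prod hl hb))).differentiableAt (by simp)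
  have h1 := hasDerivAt_line hQd (Pi.single i 1 : Fin N → ℝ)
  have hc : HasDerivAt (fun r : ℝ => b + r • (Pi.single i 1 : Fin N → ℝ)) (Pi.single i 1) 0 := by
    simpa using ((hasDerivAt_id (0 : ℝ)).smul_const (Pi.single i 1 : Fin N → ℝ)).const_add b
  have hz0 : b + (0 : ℝ) • (Pi.single i 1 : Fin N → ℝ) = b := by simp
  have hev : ∀ᶠ r : ℝ in 𝓝 0, b + r • (Pi.single i 1 : Fin N → ℝ) ∈ B :=
    hc.continuousAt.preimage_mem_nhds (by rw [hz0]; exact hB.mem_nhds hb)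
  have hsp := speed_eq hc h1 (hasDerivAt_const (0 : ℝ) l) (hev.mono fun r hr => hs l hl _ hr) hl0
  rw [hz0] at hsp
  have h0 : ∀ m, Q (l, b) - b m ≠ 0 :=
    sub_ne_zero_of_surface_ne_zero ((hs l hl b hb).trans_ne hl0)
  have hP : logD b (Q (l, b)) ≠ 0 := by
    intro h
    apply hd l hl b hb
    rw [deriv_surface h0, h, mul_zero]
  have hsum : ∑ m, (Pi.single i 1 : Fin N → ℝ) m / (Q (l, b) - b m) = 1 / (Q (l, b) - b i) := by
    rw [Finset.sum_eq_single i] <;> simp +contextual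
  rw [hsum, zero_div, add_zero, mul_comm, ← eq_div_iff hP] at hsp
  unfold regW
  rw [hsp]
  unfold W primA logD
  simp only
  ring

theorem isInverseBranch_of_family {Q : ℝ × (Fin N → ℝ) → ℝ} {A : Set ℝ} {B Ω : Set (Fin N → ℝ)}
    (hΩ : IsOpen Ω) (hΩB : Ω ⊆ B) (hQ : ContDiffOn ℝ ω Q (A ×ˢ B))
    (hs : ∀ l ∈ A, ∀ b ∈ B, surface b (Q (l, b)) = l)
    (hd : ∀ l ∈ A, ∀ b ∈ B, deriv (surface b) (Q (l, b)) ≠ 0) {l : ℝ} (hl : l ∈ A) :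
    IsInverseBranch l Ω (fun b => Q (l, b)) where
  isOpen := hΩ
  continuousOn := hQ.continuousOn.comp (by fun_prop) fun b hb => Set.mk_mem_prod hl (hΩB hb)
  surface_eq b hb := hs l hl b (hΩB hb)
  deriv_ne_zero b hb := hd l hl b (hΩB hb)

theorem surface_root (b : Fin N → ℝ) (k : Fin N) : surface b (b k) = 0 := by
  unfold surface
  rw [Finset.prod_eq_zero (Finset.mem_univ k) (sub_self _), mul_zero]

theorem deriv_surface_root_ne_zero {b : Fin N → ℝ} (hb : Function.Injective b) (k : Fin N) :
    deriv (surface b) (b k) ≠ 0 := by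
  let h : ℝ → ℝ := fun q => (1 + q ^ 2) ^ (-(N : ℝ) / 2) * ∏ m ∈ Finset.univ.erase k, (q - b m)
  have hs : surface b = fun q => (q - b k) * h q := by
    funext q
    simp only [surface, h]
    rw [← Finset.mul_prod_erase _ _ (Finset.mem_univ k)]
    ring
  have hd : DifferentiableAt ℝ h (b k) := by
    refine DifferentiableAt.mul ?_ ?_
    · exact DifferentiableAt.rpow_const (by fun_prop) (Or.inl (one_add_sq_ne_zero _))
    · exact DifferentiableAt.fun_finsetProd fun m _ => by fun_prop
  have h1 := ((hasDerivAt_id (b k)).sub_const (b k)).mul hd.hasDerivAt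
  have h2 : deriv (surface b) (b k) = h (b k) := by
    rw [hs]
    refine h1.deriv.trans ?_
    simp
  rw [h2]
  refine mul_ne_zero (Real.rpow_pos_of_pos (by positivity) _).ne'
    (Finset.prod_ne_zero_iff.2 fun m hm => sub_ne_zero.2 fun he => ?_)
  exact Finset.ne_of_mem_erase hm (hb he).symm

/-- The branch through a root of the product: it equals the root at `l = 0`. -/
theorem exists_root_branch {b₀ : Fin N → ℝ} (hb : Function.Injective b₀) (k : Fin N) :
    ∃ (A : Set ℝ) (B : Set (Fin N → ℝ)) (Q : ℝ × (Fin N → ℝ) → ℝ),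
      IsOpen A ∧ IsOpen B ∧ (0 : ℝ) ∈ A ∧ b₀ ∈ B ∧ ContDiffOn ℝ ω Q (A ×ˢ B) ∧
      (∀ l ∈ A, ∀ b ∈ B, surface b (Q (l, b)) = l) ∧
      (∀ l ∈ A, ∀ b ∈ B, deriv (surface b) (Q (l, b)) ≠ 0) ∧
      ∀ b ∈ B, ∀ i, regW Q (0, b) i
        = primA (b k) + if i = k then C0 b * √(1 + b k ^ 2) else 0 := by
  obtain ⟨A, B, V, Q, hA, hB, hV, h0A, hbB, hqV, hQ, hVd, hiff⟩ :=
    exists_branch (surface_root b₀ k) (deriv_surface_root_ne_zero hb k)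
  -- Keeping b_k inside V makes it the unique solution there at l = 0, so Q(0, b) = b_k on a whole
  -- neighbourhood and ∂_i Q = δ_ik.
  have hB' : IsOpen (B ∩ {b | b k ∈ V}) := hB.inter (hV.preimage (continuous_apply k))
  have hroot : ∀ b ∈ B ∩ {b | b k ∈ V}, Q (0, b) = b k := fun b hb =>
    ((hiff 0 h0A b hb.1 (b k) hb.2).1 (surface_root b k)).symm
  refine ⟨A, B ∩ {b | b k ∈ V}, Q, hA, hB', h0A, ⟨hbB, hqV⟩,
    hQ.mono (Set.prod_mono_right Set.inter_subset_left),
    fun l hl b hb => (hiff l hl b hb.1 _ (hVd l hl b hb.1).1).2 rfl,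
    fun l hl b hb => (hVd l hl b hb.1).2, fun b hb i => ?_⟩
  have hQd : DifferentiableAt ℝ Q (0, b) :=
    (hQ.contDiffAt ((hA.prod hB).mem_nhds (Set.mk_mem_prod h0A hb.1))).differentiableAt (by simp)
  have h1 := hasDerivAt_line hQd (Pi.single i 1 : Fin N → ℝ)
  have hc : HasDerivAt (fun r : ℝ => b + r • (Pi.single i 1 : Fin N → ℝ)) (Pi.single i 1) 0 := by
    simpa using ((hasDerivAt_id (0 : ℝ)).smul_const (Pi.single i 1 : Fin N → ℝ)).const_add b
  have hev : ∀ᶠ r : ℝ in 𝓝 0, b + r • (Pi.single i 1 : Fin N → ℝ) ∈ B ∩ {b | b k ∈ V} :=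
    hc.continuousAt.preimage_mem_nhds (by simpa using hB'.mem_nhds hb)
  have h2 := (hasDerivAt_pi.1 hc k).congr_of_eventuallyEq (hev.mono fun r hr => hroot _ hr)
  have h3 := h1.unique h2
  unfold regW
  rw [h3, hroot b hb]
  by_cases hik : i = k
  · subst hik
    simp
  · simp [hik]

end GeodHydro

/-! ### Multiparameter families by superposition. -/

namespace GeodHydro

open Filter Topology

variable {N M : ℕ}

/-- The superposed hodograph system written through families of branches. -/
noncomputable def superDefect (c : Fin M → Fin N) (Q : Fin N → ℝ × (Fin N → ℝ) → ℝ)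
    (y : (((Fin M → ℝ) × (Fin M → ℝ)) × (ℝ × ℝ)) × (Fin N → ℝ)) (i : Fin N) : ℝ :=
  ∑ j, y.1.1.2 j * regW (Q (c j)) (y.1.1.1 j, y.2) i
    - (y.1.2.1 + y.1.2.2 * (2 * C1 y.2 - C0 y.2 * y.2 i))

theorem contDiffAt_superDefect {c : Fin M → Fin N} {Q : Fin N → ℝ × (Fin N → ℝ) → ℝ}
    {y : (((Fin M → ℝ) × (Fin M → ℝ)) × (ℝ × ℝ)) × (Fin N → ℝ)}
    (hQ : ∀ j, ContDiffAt ℝ ω (Q (c j)) (y.1.1.1 j, y.2)) :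
    ContDiffAt ℝ ω (superDefect c Q) y := by
  refine contDiffAt_pi.2 fun i => ?_
  unfold superDefect
  have hp : ContDiff ℝ ω (fun y : (((Fin M → ℝ) × (Fin M → ℝ)) × (ℝ × ℝ)) × (Fin N → ℝ) =>
      y.1.2.1 + y.1.2.2 * (2 * C1 y.2 - C0 y.2 * y.2 i)) := by
    have h1 := (contDiff_C0 (N := N)).comp (contDiff_snd (𝕜 := ℝ) (n := ω)
      (E := ((Fin M → ℝ) × (Fin M → ℝ)) × (ℝ × ℝ)))
    have h2 := (contDiff_C1 (N := N)).comp (contDiff_snd (𝕜 := ℝ) (n := ω)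
      (E := ((Fin M → ℝ) × (Fin M → ℝ)) × (ℝ × ℝ)))
    simp only [Function.comp_def] at h1 h2
    fun_prop
  refine (ContDiffAt.sum fun j _ => ContDiffAt.mul (by fun_prop) ?_).sub hp.contDiffAt
  exact (contDiffAt_regW (hQ j) i).comp y
    (f := fun y : (((Fin M → ℝ) × (Fin M → ℝ)) × (ℝ × ℝ)) × (Fin N → ℝ) => (y.1.1.1 j, y.2))
    (by fun_prop)

theorem sum_extend (hNM : N ≤ M) {c : Fin M → Fin N} (hc : ∀ k, c (Fin.castLE hNM k) = k)
    (F : Fin N → ℝ) : ∑ j : Fin M, (if (j : ℕ) < N then F (c j) else 0) = ∑ k, F k := by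
  symm
  refine Finset.sum_of_injOn (Fin.castLE hNM) (Fin.castLE_injective hNM).injOn (by simp) ?_ ?_
  · intro j _ hj
    rw [if_neg]
    intro hlt
    exact hj ⟨⟨j, hlt⟩, by simp, rfl⟩
  · intro k _
    simp [hc]

theorem sum_log_div_neg (hN : 1 ≤ N) {b : Fin N → ℝ} (hb : ∀ k, 0 < b k) :
    ∑ k, Real.log (√(1 + b k ^ 2) - b k) / √(1 + b k ^ 2) < 0 := by
  have : Nonempty (Fin N) := ⟨⟨0, hN⟩⟩
  refine Finset.sum_neg (fun k _ => ?_) Finset.univ_nonempty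
  have h1 : √(1 + b k ^ 2) < 1 + b k := by
    rw [Real.sqrt_lt' (by linarith [hb k])]
    nlinarith [hb k]
  exact div_neg_of_neg_of_pos
    (Real.log_neg (sqrt_one_add_sq_sub_pos _) (by linarith)) (by positivity)

/-- The matrix is diagonal plus rank one. A kernel vector is determined by s = ∑ `primA`(b_k) v_k,
and substituting it back gives s ∑ log(√(1+b_k²) - b_k)/√(1+b_k²) = 0. For positive b_k all the
logarithms are negative, so s = 0. -/
theorem det_limit_ne_zero (hN : 1 ≤ N) {b : Fin N → ℝ} (hb : ∀ k, 0 < b k) :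
    (Matrix.of fun i k : Fin N =>
      primA (b k) + if i = k then C0 b * √(1 + b k ^ 2) else 0).det ≠ 0 := by
  intro hdet
  obtain ⟨v, hv, hv0⟩ := Matrix.exists_mulVec_eq_zero_iff.2 hdet
  apply hv
  have hC : 0 < C0 b := by
    have : Nonempty (Fin N) := ⟨⟨0, hN⟩⟩
    exact Finset.sum_pos (fun k _ => hb k) Finset.univ_nonempty
  have h1 : ∀ i, (∑ k, primA (b k) * v k) + C0 b * √(1 + b i ^ 2) * v i = 0 := by
    intro i
    have := congrFun hv0 i
    simpa [Matrix.mulVec, dotProduct, add_mul, Finset.sum_add_distrib] using this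
  set s := ∑ k, primA (b k) * v k with hs
  have h2 : ∀ i, v i = -s / (C0 b * √(1 + b i ^ 2)) := by
    intro i
    have := sqrt_one_add_sq_ne_zero (b i)
    rw [eq_div_iff (mul_ne_zero hC.ne' this)]
    linarith [h1 i]
  have h3 : s * ∑ k, Real.log (√(1 + b k ^ 2) - b k) / √(1 + b k ^ 2) = 0 := by
    have h4 : s * C0 b = -s * ∑ k, primA (b k) / √(1 + b k ^ 2) := by
      conv_lhs => rw [hs]
      rw [Finset.sum_mul, Finset.mul_sum]
      refine Finset.sum_congr rfl fun k _ => ?_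
      have := sqrt_one_add_sq_ne_zero (b k)
      rw [h2 k]
      field_simp
    have h5 : ∑ k, primA (b k) / √(1 + b k ^ 2)
        = (∑ k, Real.log (√(1 + b k ^ 2) - b k) / √(1 + b k ^ 2)) - C0 b := by
      unfold C0
      rw [← Finset.sum_sub_distrib]
      refine Finset.sum_congr rfl fun k _ => ?_
      have := sqrt_one_add_sq_ne_zero (b k)
      unfold primA
      field_simp
    rw [h5] at h4
    linarith
  have h6 : s = 0 := (mul_eq_zero.1 h3).resolve_right (sum_log_div_neg hN hb).ne
  funext i
  rw [h2 i, h6]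
  simp

theorem superDefect_limit (hNM : N ≤ M) {c : Fin M → Fin N}
    (hc : ∀ k, c (Fin.castLE hNM k) = k) {Q : Fin N → ℝ × (Fin N → ℝ) → ℝ} {b : Fin N → ℝ}
    (hQ : ∀ k i, regW (Q k) (0, b) i = primA (b k) + if i = k then C0 b * √(1 + b k ^ 2) else 0)
    (τ : Fin N → ℝ) (z : ℝ × ℝ) (i : Fin N) :
    superDefect c Q (((0, fun j => if (j : ℕ) < N then τ (c j) else 0), z), b) i
      = (∑ k, τ k * primA (b k)) + τ i * (C0 b * √(1 + b i ^ 2))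
        - (z.1 + z.2 * (2 * C1 b - C0 b * b i)) := by
  unfold superDefect
  simp only [Pi.zero_apply, hQ, ite_mul, zero_mul]
  rw [sum_extend hNM hc
    (fun k => τ k * (primA (b k) + if i = k then C0 b * √(1 + b k ^ 2) else 0))]
  simp [mul_add, Finset.sum_add_distrib]

/-- At λ = 0, t = 1 the weights τ_k = -b_k/√(1+b_k²) make every ∂_k Φ = τ_k √(1+b_k²) + b_k vanish,
while Hess Φ is diagonal with entries 1 - b_k²/(1+b_k²) = 1/(1+b_k²). The linearization is thus u_i
↦ C⁰ u_i/(1+b_i²), which is injective. -/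
theorem superDefect_kernel (hNM : N ≤ M) {c : Fin M → Fin N}
    (hc : ∀ k, c (Fin.castLE hNM k) = k) {Q : Fin N → ℝ × (Fin N → ℝ) → ℝ} {b₀ : Fin N → ℝ}
    (hQ : ∀ᶠ b in 𝓝 b₀, ∀ k i, regW (Q k) (0, b) i
      = primA (b k) + if i = k then C0 b * √(1 + b k ^ 2) else 0) (hC : C0 b₀ ≠ 0) {x : ℝ}
    {p₀ : ((Fin M → ℝ) × (Fin M → ℝ)) × (ℝ × ℝ)}
    (hp₀ : p₀ = ((0, fun j : Fin M => if (j : ℕ) < N then -b₀ (c j) / √(1 + b₀ (c j) ^ 2) else 0), (x, 1)))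
    (hd : DifferentiableAt ℝ (superDefect c Q) (p₀, b₀)) (u : Fin N → ℝ)
    (hu : fderiv ℝ (superDefect c Q) (p₀, b₀) (0, u) = 0) : u = 0 := by
  have h1 := hasDerivAt_line hd u
  rw [hu] at h1
  have hline : HasDerivAt (fun r : ℝ => b₀ + r • u) u 0 := by
    simpa using ((hasDerivAt_id (0 : ℝ)).smul_const u).const_add b₀
  have hz0 : b₀ + (0 : ℝ) • u = b₀ := by simp
  have hev : ∀ᶠ r : ℝ in 𝓝 0, ∀ k i, regW (Q k) (0, b₀ + r • u) i
      = primA ((b₀ + r • u) k)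
        + if i = k then C0 (b₀ + r • u) * √(1 + (b₀ + r • u) k ^ 2) else 0 :=
    hline.continuousAt.tendsto.eventually (by rw [hz0]; exact hQ)
  set τ : Fin N → ℝ := fun k => -b₀ k / √(1 + b₀ k ^ 2) with hτ
  have hm := hasDerivAt_pi.1 hline
  have hC' := hasDerivAt_C0 hline
  funext i
  have h2 : HasDerivAt (fun r : ℝ => (∑ k, τ k * primA ((b₀ + r • u) k))
      + τ i * (C0 (b₀ + r • u) * √(1 + (b₀ + r • u) i ^ 2))
      - (x + 1 * (2 * C1 (b₀ + r • u) - C0 (b₀ + r • u) * (b₀ + r • u) i))) _ 0 :=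
    ((HasDerivAt.fun_sum fun k _ => (hasDerivAt_primA (hm k)).const_mul (τ k)).add
      ((hC'.mul (hasDerivAt_sqrt_one_add_sq (hm i))).const_mul (τ i))).sub
      (hasDerivAt_hodographLHS hline (hasDerivAt_const (0 : ℝ) x) (hasDerivAt_const (0 : ℝ) 1) i)
  have h3 := (hasDerivAt_pi.1 h1 i).congr_of_eventuallyEq (f₁ := fun r : ℝ =>
      (∑ k, τ k * primA ((b₀ + r • u) k))
      + τ i * (C0 (b₀ + r • u) * √(1 + (b₀ + r • u) i ^ 2))
      - (x + 1 * (2 * C1 (b₀ + r • u) - C0 (b₀ + r • u) * (b₀ + r • u) i))) (by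
    filter_upwards [hev] with r hr
    rw [hp₀]
    exact (superDefect_limit hNM hc hr τ (x, 1) i).symm)
  have h4 := h3.unique h2
  simp only [hz0, Pi.zero_apply] at h4
  have hτs : ∀ k, τ k * √(1 + b₀ k ^ 2) = -b₀ k := fun k => by
    have := sqrt_one_add_sq_ne_zero (b₀ k)
    simp only [hτ]
    field_simp
  have h5 : ∑ k, τ k * (-2 * √(1 + b₀ k ^ 2) * u k) = 2 * ∑ k, b₀ k * u k := by
    rw [Finset.mul_sum]
    refine Finset.sum_congr rfl fun k _ => ?_
    linear_combination (-2 * u k) * hτs k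
  rw [h5] at h4
  have h6 := one_add_sq_ne_zero (b₀ i)
  have h7 : C0 b₀ * u i / (1 + b₀ i ^ 2) = 0 := by
    have h8 : C0 b₀ * u i / (1 + b₀ i ^ 2)
        = C0 b₀ * u i - C0 b₀ * b₀ i * (b₀ i / (1 + b₀ i ^ 2)) * u i := by
      field_simp
      ring
    rw [h8]
    linear_combination (-1 : ℝ) * h4 - ((∑ m, u m) + C0 b₀ * (b₀ i / (1 + b₀ i ^ 2)) * u i) * hτs i
  simpa [hC, h6] using h7

theorem exists_multiparameter_family (hN : 1 ≤ N) (hNM : N ≤ M) :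
      ∃ (Λ S : Set (Fin M → ℝ)) (Ω : Set (Fin N → ℝ)) (U : Set (ℝ × ℝ))
        (q : Fin M → ℝ → (Fin N → ℝ) → ℝ)
        (β : (Fin M → ℝ) → (Fin M → ℝ) → ℝ × ℝ → Fin N → ℝ),
        IsOpen Λ ∧ Λ.Nonempty ∧ IsOpen S ∧ S.Nonempty ∧ IsOpen U ∧ U.Nonempty ∧
        (∀ l ∈ Λ, Function.Injective l ∧
          ∀ j, l j ≠ 0 ∧ IsInverseBranch (l j) Ω (q j (l j))) ∧
        (∀ j, ContDiffOn ℝ ∞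
          (fun y : (Fin M → ℝ) × (Fin N → ℝ) => q j (y.1 j) y.2) (Λ ×ˢ Ω)) ∧
        ContDiffOn ℝ ∞
          (fun y : ((Fin M → ℝ) × (Fin M → ℝ)) × (ℝ × ℝ) => β y.1.1 y.1.2 y.2)
          ((Λ ×ˢ S) ×ˢ U) ∧
        (∀ l ∈ Λ, ∀ σ ∈ S, ∀ z ∈ U, β l σ z ∈ Ω ∧ C0 (β l σ z) ≠ 0 ∧
          Function.Injective (β l σ z) ∧
          ∀ b ∈ Ω, SuperHodograph z.1 z.2 b σ (fun j => q j (l j) b) ↔ b = β l σ z) ∧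
        (M = N → ∀ l ∈ Λ, ∀ σ ∈ S, ∀ σ' ∈ S, σ ≠ σ' →
          ∃ z ∈ U, β l σ z ≠ β l σ' z) := by
  -- Any point with distinct positive coordinates would serve: distinct for simple roots, positive
  -- for the determinant and for C⁰ ≠ 0.
  let b₀ : Fin N → ℝ := fun k => (k : ℝ) + 1
  have hb₀pos : ∀ k, 0 < b₀ k := fun k => by positivity
  have hb₀inj : Function.Injective b₀ := fun i j hij => by
    have : (i : ℝ) = j := by simpa [b₀] using hij
    exact Fin.ext (by exact_mod_cast this)
  have hC : C0 b₀ ≠ 0 := by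
    have : Nonempty (Fin N) := ⟨⟨0, hN⟩⟩
    exact (Finset.sum_pos (fun k _ => hb₀pos k) Finset.univ_nonempty).ne'
  -- The j-th term uses the branch through root j mod N. At the base point only the first N weights
  -- are nonzero, but all are free to vary.
  let c : Fin M → Fin N := fun j => ⟨j % N, Nat.mod_lt _ hN⟩
  have hc : ∀ k, c (Fin.castLE hNM k) = k := fun k => Fin.ext (Nat.mod_eq_of_lt k.2)
  choose A B Q hA hB h0A hbB hQ hs hd hreg using exists_root_branch hb₀inj
  have hB' : IsOpen (⋂ k, B k) := isOpen_iInter_of_finite hB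
  have hbB' : b₀ ∈ ⋂ k, B k := Set.mem_iInter.2 hbB
  have hQat : ∀ k, ContDiffAt ℝ ω (Q k) (0, b₀) := fun k =>
    (hQ k).contDiffAt (((hA k).prod (hB k)).mem_nhds ⟨h0A k, hbB k⟩)
  -- With t = 1 the terms in C⁰ b_i cancel against the weights, and this x makes all N equations
  -- hold.
  let x₀ : ℝ := (∑ k, -b₀ k / √(1 + b₀ k ^ 2) * primA (b₀ k)) - 2 * C1 b₀
  let σ₀ : Fin M → ℝ := fun j => if (j : ℕ) < N then -b₀ (c j) / √(1 + b₀ (c j) ^ 2) else 0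
  let p₀ : ((Fin M → ℝ) × (Fin M → ℝ)) × (ℝ × ℝ) := ((0, σ₀), (x₀, 1))
  have hf : ContDiffAt ℝ ω (superDefect c Q) (p₀, b₀) :=
    contDiffAt_superDefect fun j => hQat (c j)
  have hf0 : superDefect c Q (p₀, b₀) = 0 := by
    funext i
    have h1 := superDefect_limit hNM hc (Q := Q) (fun k i => hreg k b₀ (hbB k) i)
      (fun k => -b₀ k / √(1 + b₀ k ^ 2)) (x₀, 1) i
    refine h1.trans ?_
    have := sqrt_one_add_sq_ne_zero (b₀ i)
    simp only [x₀, Pi.zero_apply]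
    field_simp
    ring
  have hker := superDefect_kernel hNM hc (Q := Q) (b₀ := b₀) (x := x₀) (p₀ := p₀)
    (by filter_upwards [hB'.mem_nhds hbB'] with b hb k i using hreg k b (Set.mem_iInter.1 hb k) i)
    hC rfl (hf.differentiableAt (by simp))
  -- The determinant of the system as a linear system in the first N weights; when M = N, its
  -- nonvanishing lets b determine σ.
  let D : (((Fin M → ℝ) × (Fin M → ℝ)) × (ℝ × ℝ)) × (Fin N → ℝ) → ℝ := fun y =>
    (Matrix.of fun i k : Fin N => regW (Q k) (y.1.1.1 (Fin.castLE hNM k), y.2) i).det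
  have hDc : ContinuousAt D (p₀, b₀) := by
    have hent : ContinuousAt (fun y : (((Fin M → ℝ) × (Fin M → ℝ)) × (ℝ × ℝ)) × (Fin N → ℝ) =>
        (Matrix.of fun i k : Fin N => regW (Q k) (y.1.1.1 (Fin.castLE hNM k), y.2) i))
        (p₀, b₀) := by
      refine continuousAt_pi.2 fun i => continuousAt_pi.2 fun k => ?_
      exact ContinuousAt.comp (f := fun y : (((Fin M → ℝ) × (Fin M → ℝ)) × (ℝ × ℝ)) ×
        (Fin N → ℝ) => (y.1.1.1 (Fin.castLE hNM k), y.2)) (x := (p₀, b₀))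
        (contDiffAt_regW (hQat k) i).continuousAt (by fun_prop)
    exact (Continuous.matrix_det continuous_id).continuousAt.comp hent
  have hD0 : D (p₀, b₀) ≠ 0 := by
    have : D (p₀, b₀) = (Matrix.of fun i k : Fin N =>
        primA (b₀ k) + if i = k then C0 b₀ * √(1 + b₀ k ^ 2) else 0).det := by
      simp only [D, p₀, Pi.zero_apply]
      congr 2
      funext i k
      exact hreg k b₀ (hbB k) i
    rw [this]
    exact det_limit_ne_zero hN hb₀pos
  have hO : {y : (((Fin M → ℝ) × (Fin M → ℝ)) × (ℝ × ℝ)) × (Fin N → ℝ) |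
      (∀ j, y.1.1.1 j ∈ A (c j)) ∧ (∀ k, y.2 ∈ B k) ∧ C0 y.2 ≠ 0 ∧ Function.Injective y.2 ∧
        D y ≠ 0} ∈ 𝓝 (p₀, b₀) := by
    have h1 : ∀ᶠ y : (((Fin M → ℝ) × (Fin M → ℝ)) × (ℝ × ℝ)) × (Fin N → ℝ) in 𝓝 (p₀, b₀),
        ∀ j, y.1.1.1 j ∈ A (c j) := by
      refine eventually_all.2 fun j => ?_
      have : ContinuousAt (fun y : (((Fin M → ℝ) × (Fin M → ℝ)) × (ℝ × ℝ)) × (Fin N → ℝ) =>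
        y.1.1.1 j) (p₀, b₀) := by fun_prop
      exact this.preimage_mem_nhds ((hA _).mem_nhds (h0A _))
    have h2 : ∀ᶠ y : (((Fin M → ℝ) × (Fin M → ℝ)) × (ℝ × ℝ)) × (Fin N → ℝ) in 𝓝 (p₀, b₀),
        ∀ k, y.2 ∈ B k :=
      eventually_all.2 fun k => continuousAt_snd.preimage_mem_nhds ((hB k).mem_nhds (hbB k))
    have h3 : ∀ᶠ y : (((Fin M → ℝ) × (Fin M → ℝ)) × (ℝ × ℝ)) × (Fin N → ℝ) in 𝓝 (p₀, b₀),
        C0 y.2 ≠ 0 :=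
      ((contDiff_C0.continuous.comp continuous_snd).continuousAt).eventually_ne hC
    have h4 : ∀ᶠ y : (((Fin M → ℝ) × (Fin M → ℝ)) × (ℝ × ℝ)) × (Fin N → ℝ) in 𝓝 (p₀, b₀),
        Function.Injective y.2 := by
      have : ∀ᶠ y : (((Fin M → ℝ) × (Fin M → ℝ)) × (ℝ × ℝ)) × (Fin N → ℝ) in 𝓝 (p₀, b₀),
          ∀ i j, i ≠ j → y.2 i ≠ y.2 j := by
        refine eventually_all.2 fun i => eventually_all.2 fun j => ?_
        by_cases hij : i = j
        · exact Eventually.of_forall fun y hne => absurd hij hne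
        · have ha : ∀ i, ContinuousAt (fun y : (((Fin M → ℝ) × (Fin M → ℝ)) × (ℝ × ℝ)) ×
              (Fin N → ℝ) => y.2 i) (p₀, b₀) := fun i => by fun_prop
          exact (((ha i).ne_iff_eventually_ne (ha j)).1 fun h => hij (hb₀inj h)).mono
            fun y hy _ => hy
      exact this.mono fun y hy i j hij => by_contra fun hne => hy i j hne hij
    filter_upwards [h1, h2, h3, h4, hDc.eventually_ne hD0] with y a1 a2 a3 a4 a5
    exact ⟨a1, a2, a3, a4, a5⟩
  obtain ⟨P, Ω, β, hP, hΩ, hpP, hbΩ, hβ, hsub, hmaps, hiff⟩ :=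
    exists_implicit_family hf hf0 hker hO
  obtain ⟨PL, U, hPL, hpPL, hU, hzU, hPU⟩ := mem_nhds_prod_iff'.1 (hP.mem_nhds hpP)
  obtain ⟨L, S, hL, h0L, hS, hσS, hLS⟩ := mem_nhds_prod_iff'.1 (hPL.mem_nhds hpPL)
  -- The base value λ = 0 is excluded from Λ but is a limit of it, along ε(1, …, M).
  let Λ : Set (Fin M → ℝ) := L ∩ {l | (∀ i j, i ≠ j → l i ≠ l j) ∧ ∀ j, l j ≠ 0}
  have hmem : ∀ l ∈ Λ, ∀ σ ∈ S, ∀ z ∈ U, ((l, σ), z) ∈ P := fun l hl σ hσ z hz =>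
    hPU (Set.mk_mem_prod (hLS (Set.mk_mem_prod hl.1 hσ)) hz)
  have hgood := fun l (hl : l ∈ Λ) σ (hσ : σ ∈ S) z (hz : z ∈ U) b (hb : b ∈ Ω) =>
    hsub (Set.mk_mem_prod (hmem l hl σ hσ z hz) hb)
  have hlA : ∀ l ∈ Λ, ∀ j, l j ∈ A (c j) := fun l hl => (hgood l hl σ₀ hσS _ hzU b₀ hbΩ).1
  have hΩB : ∀ k, Ω ⊆ B k := fun k b hb =>
    (hsub (Set.mk_mem_prod hpP hb)).2.1 k
  have hhod : ∀ l ∈ Λ, ∀ σ : Fin M → ℝ, ∀ z : ℝ × ℝ, ∀ b ∈ Ω,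
      SuperHodograph z.1 z.2 b σ (fun j => Q (c j) (l j, b))
        ↔ superDefect c Q (((l, σ), z), b) = 0 := by
    intro l hl σ z b hb
    have hW : ∀ j i, regW (Q (c j)) (l j, b) i = W b (Q (c j) (l j, b)) i := fun j i =>
      regW_eq (hA _) (hB _) (hQ _) (hs _) (hd _) (hlA l hl j) (hl.2.2 j) (hΩB _ hb) i
    rw [funext_iff]
    refine forall_congr' fun i => ?_
    simp only [superDefect, hW, Pi.zero_apply]
    rw [sub_eq_zero, eq_comm]
  refine ⟨Λ, S, Ω, U, fun j l b => Q (c j) (l, b), fun l σ z => β ((l, σ), z), ?_, ?_, hS,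
    ⟨σ₀, hσS⟩, hU, ⟨_, hzU⟩, ?_, ?_, ?_, ?_, ?_⟩
  · refine hL.inter (IsOpen.and ?_ ?_)
    · simp only [Set.ofPred_forall]
      exact isOpen_iInter_of_finite fun i => isOpen_iInter_of_finite fun j =>
        isOpen_iInter_of_finite fun _ => isOpen_ne_fun (continuous_apply i) (continuous_apply j)
    · simp only [Set.ofPred_forall]
      exact isOpen_iInter_of_finite fun j => isOpen_ne_fun (continuous_apply j) continuous_const
  · have ht : Tendsto (fun ε : ℝ => fun j : Fin M => ε * ((j : ℝ) + 1)) (𝓝[>] 0) (𝓝 0) := by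
      have : Continuous (fun ε : ℝ => fun j : Fin M => ε * ((j : ℝ) + 1)) := by fun_prop
      have h := this.tendsto 0
      simp only [zero_mul] at h
      exact h.mono_left nhdsWithin_le_nhds
    obtain ⟨ε, h1, h2⟩ := ((ht.eventually (hL.mem_nhds h0L)).and self_mem_nhdsWithin).exists
    have h2' : (0 : ℝ) < ε := h2
    refine ⟨_, h1, fun i j hij he => hij (Fin.ext ?_), fun j => ?_⟩
    · have := mul_left_cancel₀ h2'.ne' he
      have h3 : (i : ℝ) = j := by linarith
      exact_mod_cast h3
    · positivity
  · intro l hl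
    refine ⟨fun i j hij => by_contra fun hne => hl.2.1 i j hne hij, fun j => ⟨hl.2.2 j, ?_⟩⟩
    exact isInverseBranch_of_family hΩ (hΩB _) (hQ _) (hs _) (hd _) (hlA l hl j)
  · intro j
    refine ((hQ (c j)).of_le (by simp)).comp
      (f := fun y : (Fin M → ℝ) × (Fin N → ℝ) => (y.1 j, y.2)) (by fun_prop) ?_
    intro y hy
    exact ⟨hlA _ hy.1 j, hΩB _ hy.2⟩
  · exact (hβ.of_le (by simp)).mono fun y hy => hmem _ hy.1.1 _ hy.1.2 _ hy.2
  · intro l hl σ hσ z hz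
    have hβΩ := hmaps _ (hmem l hl σ hσ z hz)
    obtain ⟨-, -, h3, h4, -⟩ := hgood l hl σ hσ z hz _ hβΩ
    exact ⟨hβΩ, h3, h4, fun b hb => (hhod l hl σ z b hb).trans (hiff _ (hmem l hl σ hσ z hz) b hb)⟩
  · intro hMN l hl σ hσ σ' hσ' hne
    subst hMN
    refine ⟨(x₀, 1), hzU, fun heq => hne ?_⟩
    have h1 := hmem l hl σ hσ (x₀, 1) hzU
    have h2 := hmem l hl σ' hσ' (x₀, 1) hzU
    have hb := hmaps _ h1
    have e1 := (hiff _ h1 _ hb).2 rfl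
    have e2 := (hiff _ h2 _ hb).2 heq
    obtain ⟨-, -, -, -, hdet⟩ := hgood l hl σ hσ _ hzU _ hb
    have hcid : ∀ k : Fin M, c k = k := fun k => hc k
    -- If σ and σ' give the same b at the base (x, t), subtracting the two systems puts σ - σ' in
    -- the kernel of an invertible matrix.
    have hv : (Matrix.of fun i k : Fin M => regW (Q k) (l k, β ((l, σ), (x₀, 1))) i).mulVec
        (σ - σ') = 0 := by
      funext i
      have f1 := congrFun e1 i
      have f2 := congrFun e2 i
      simp only [superDefect, hcid, Pi.zero_apply] at f1 f2
      simp only [Matrix.mulVec, dotProduct, Matrix.of_apply, Pi.sub_apply, mul_sub,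
        Finset.sum_sub_distrib, Pi.zero_apply, mul_comm _ (σ _), mul_comm _ (σ' _)]
      linarith
    exact sub_eq_zero.1 (Matrix.eq_zero_of_mulVec_eq_zero hdet hv)

end GeodHydro

/-! ### Linearization at the base point for a single parameter. -/

namespace GeodHydro

/-- The two scalar linear equations satisfied by a velocity taking two values `u₁` (`n` times)
and `u₂` (once) at the base point. -/
theorem two_group_equations {n a c u₁ u₂ q' δ D' V P R C : ℝ} (ha : a ≠ 0) (hc : c ≠ 0)
    (hac : a ≠ c) (hP : P = n * a + c) (hR : R = n * c + a) (hP0 : P ≠ 0) (hR0 : R ≠ 0)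
    (hC : C = -(n / a + 1 / c)) (hq : P * q' = n * (a * u₁) + c * u₂ + δ) (hV : V = n * u₁ + u₂)
    (hD' : D' = -(n * ((q' - u₁) * a ^ 2) + (q' - u₂) * c ^ 2) - (n + 1) * q')
    (h₁ : -2 * q' + V * a / P + C * (-((q' - u₁) * a ^ 2 / P) - D' * a / P ^ 2)
      = -(a * c / P) * (2 * (n * (-1 / a * u₁) + -1 / c * u₂) - V * (-1 / a) - C * u₁))
    (h₂ : -2 * q' + V * c / P + C * (-((q' - u₂) * c ^ 2 / P) - D' * c / P ^ 2)
      = -(a * c / P) * (2 * (n * (-1 / a * u₁) + -1 / c * u₂) - V * (-1 / c) - C * u₂)) :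
    ((n - 1) * a * c * P + n * (a - c) * (a * c - 1)) * (u₁ - u₂) - P * V
        + δ * (n + 1) * (a * c - 1) = 0 ∧
      P ^ 2 * V + R * (n ^ 2 * a - c) * (u₁ - u₂) + δ * (n + 1) * (2 * P + R) = 0 := by
  have hac' : a - c ≠ 0 := sub_ne_zero.2 hac
  have hca : c - a ≠ 0 := sub_ne_zero.2 hac.symm
  have hδ : δ = P * q' - (n * (a * u₁) + c * u₂) := by rw [hq]; ring
  rw [← sub_eq_zero] at h₁ h₂
  set E₁ := -2 * q' + V * a / P + C * (-((q' - u₁) * a ^ 2 / P) - D' * a / P ^ 2)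
      - -(a * c / P) * (2 * (n * (-1 / a * u₁) + -1 / c * u₂) - V * (-1 / a) - C * u₁) with hE₁
  set E₂ := -2 * q' + V * c / P + C * (-((q' - u₂) * c ^ 2 / P) - D' * c / P ^ 2)
      - -(a * c / P) * (2 * (n * (-1 / a * u₁) + -1 / c * u₂) - V * (-1 / c) - C * u₂) with hE₂
  have hCR : C = -R / (a * c) := by
    rw [hC, hR]
    field_simp
  -- E₁ - E₂ removes the common term -2q', while a E₂ - c E₁, used in `key₂`, removes the terms
  -- proportional to a and c.
  have key₁ : R * (c - a) * (((n - 1) * a * c * P + n * (a - c) * (a * c - 1)) * (u₁ - u₂) - P * V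
        + δ * (n + 1) * (a * c - 1)) = -(a * c * P ^ 3) * (E₁ - E₂) := by
    rw [hE₁, hE₂, hδ, hCR, hD', hV]
    field_simp
    rw [hP, hR]
    ring
  have key₂ : (a - c) * (P ^ 2 * V + R * (n ^ 2 * a - c) * (u₁ - u₂) + δ * (n + 1) * (2 * P + R))
      = -((n + 1) * P ^ 2) * (a * E₂ - c * E₁) := by
    rw [hE₁, hE₂, hδ, hCR, hD', hV]
    field_simp
    rw [hP, hR]
    ring
  rw [h₁, h₂] at key₁ key₂
  constructor
  · have : R * (c - a) ≠ 0 := mul_ne_zero hR0 hca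
    refine (mul_eq_zero.1 (key₁.trans ?_)).resolve_left this
    ring
  · refine (mul_eq_zero.1 (key₂.trans ?_)).resolve_left hac'
    ring

/-- For δ = 0, eliminating V leaves (u₁ - u₂) times a product that is nonzero when a dominates |c|.
For δ ≠ 0, u = 0 would leave δ(n+1)(2P + R) = 0. If V = 0, eliminating u₁ - u₂ leaves δ(n+1)P times
the genericity expression, which must then vanish. -/
theorem two_group_conclusions {n a c u₁ u₂ δ V P R : ℝ} (hn : 1 ≤ n) (ha : 0 < a) (hc : c ≠ 0)
    (hac : (n + 2) * |c| < a) (hP : P = n * a + c) (hR : R = n * c + a) (hV : V = n * u₁ + u₂)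
    (h₁ : ((n - 1) * a * c * P + n * (a - c) * (a * c - 1)) * (u₁ - u₂) - P * V
        + δ * (n + 1) * (a * c - 1) = 0)
    (h₂ : P ^ 2 * V + R * (n ^ 2 * a - c) * (u₁ - u₂) + δ * (n + 1) * (2 * P + R) = 0) :
    (δ = 0 → u₁ = 0 ∧ u₂ = 0) ∧ (δ ≠ 0 → ¬(u₁ = 0 ∧ u₂ = 0)) ∧
      (δ ≠ 0 → (n - 1) * (a * c) * (2 * P + R) + (n + 1) * (a * c - 1) * (a - n * c) ≠ 0 →
        V ≠ 0) := by
  have hc1 := neg_abs_le c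
  have hc2 := le_abs_self c
  have habs := abs_nonneg c
  have hP0 : 0 < P := by rw [hP]; nlinarith
  have hR0 : 0 < R := by rw [hR]; nlinarith
  have hn2 : 0 < n ^ 2 * a - c := by nlinarith
  refine ⟨fun hδ => ?_, fun hδ hu => ?_, fun hδ hgen hV0 => ?_⟩
  · rw [hδ] at h₁ h₂
    have hD : (a * c * ((n ^ 2 * a - c) * P + (n ^ 2 - 1) * (n + 1))) * (u₁ - u₂) = 0 := by
      have : a * c * ((n ^ 2 * a - c) * P + (n ^ 2 - 1) * (n + 1))
          = P * ((n - 1) * a * c * P + n * (a - c) * (a * c - 1)) + R * (n ^ 2 * a - c) := by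
        rw [hP, hR]
        ring
      rw [this]
      linear_combination P * h₁ + h₂
    have hpos : 0 < (n ^ 2 * a - c) * P + (n ^ 2 - 1) * (n + 1) := by
      have := mul_pos hn2 hP0
      have h3 : 0 ≤ (n ^ 2 - 1) * (n + 1) := by
        apply mul_nonneg <;> nlinarith
      linarith
    have hD0 : u₁ - u₂ = 0 :=
      (mul_eq_zero.1 hD).resolve_left (mul_ne_zero (mul_ne_zero ha.ne' hc) hpos.ne')
    rw [hD0] at h₁
    have hV0 : V = 0 := by
      have : P * V = 0 := by linarith
      exact (mul_eq_zero.1 this).resolve_left hP0.ne'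
    have h12 : u₁ = u₂ := sub_eq_zero.1 hD0
    have : (n + 1) * u₂ = 0 := by rw [← hV0, hV, h12]; ring
    have hu2 : u₂ = 0 := (mul_eq_zero.1 this).resolve_left (by linarith)
    exact ⟨h12.trans hu2, hu2⟩
  · rw [hV, hu.1, hu.2] at h₂
    have : δ * (n + 1) * (2 * P + R) = 0 := by linarith
    exact (mul_ne_zero (mul_ne_zero hδ (by linarith)) (by linarith)) this
  · apply hgen
    rw [hV0] at h₁ h₂
    have h3 : δ * (n + 1) * (P * ((n - 1) * (a * c) * (2 * P + R)
        + (n + 1) * (a * c - 1) * (a - n * c))) = 0 := by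
      have e : P * ((n - 1) * (a * c) * (2 * P + R) + (n + 1) * (a * c - 1) * (a - n * c))
          = ((n - 1) * a * c * P + n * (a - c) * (a * c - 1)) * (2 * P + R)
            - R * (n ^ 2 * a - c) * (a * c - 1) := by
        rw [hP, hR]
        ring
      rw [e]
      linear_combination ((n - 1) * a * c * P + n * (a - c) * (a * c - 1)) * h₂
        - R * (n ^ 2 * a - c) * h₁
    have h4 : δ * (n + 1) ≠ 0 := mul_ne_zero hδ (by linarith)
    exact (mul_eq_zero.1 ((mul_eq_zero.1 h3).resolve_left h4)).resolve_left hP0.ne'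

/-- The inverses of the coordinates of the base point, up to sign: `a` repeated `n` times, then
`c`. -/
def baseKappa (n : ℕ) (a c : ℝ) (i : Fin (n + 1)) : ℝ :=
  Fin.lastCases (motive := fun _ => ℝ) c (fun _ => a) i

@[simp] theorem baseKappa_last (n : ℕ) (a c : ℝ) : baseKappa n a c (Fin.last n) = c := by
  simp [baseKappa]

@[simp] theorem baseKappa_castSucc (n : ℕ) (a c : ℝ) (i : Fin n) :
    baseKappa n a c i.castSucc = a := by
  simp [baseKappa]

/-- The base point of the one-parameter family. -/
noncomputable def baseB (n : ℕ) (a c : ℝ) (i : Fin (n + 1)) : ℝ := -1 / baseKappa n a c i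

section

variable {n : ℕ} {a c : ℝ}

theorem zero_sub_baseB (i : Fin (n + 1)) : 0 - baseB n a c i = 1 / baseKappa n a c i := by
  simp [baseB, neg_div]

theorem logD_baseB : logD (baseB n a c) 0 = n * a + c := by
  unfold logD
  simp only [zero_sub_baseB, one_div_one_div, Fin.sum_univ_castSucc]
  simp

theorem C0_baseB : C0 (baseB n a c) = -(n / a + 1 / c) := by
  simp [C0, baseB, Fin.sum_univ_castSucc, neg_div]
  ring

theorem surface_baseB {l : ℝ} (hl : l * a ^ n * c = 1) : surface (baseB n a c) 0 = l := by
  have h1 : a ^ n * c ≠ 0 := by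
    intro h
    rw [mul_assoc, h, mul_zero] at hl
    exact zero_ne_one hl
  unfold surface
  simp only [zero_sub_baseB, Fin.prod_univ_castSucc]
  simp only [baseKappa_last, baseKappa_castSucc, Finset.prod_const, Finset.card_univ,
    Fintype.card_fin]
  have h2 := left_ne_zero_of_mul h1
  have h3 := right_ne_zero_of_mul h1
  simp only [ne_eq, OfNat.ofNat_ne_zero, not_false_eq_true, zero_pow, add_zero, Real.one_rpow,
    one_div, inv_pow, one_mul]
  field_simp
  linarith

theorem wDot_baseB (v : Fin (n + 1) → ℝ) (q' : ℝ) (i : Fin (n + 1)) :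
    wDot (baseB n a c) 0 v q' i = -2 * q' + (∑ m, v m) * baseKappa n a c i / (n * a + c)
      + C0 (baseB n a c) * (-((q' - v i) * baseKappa n a c i ^ 2 / (n * a + c))
        - logDDot (baseB n a c) 0 v q' * baseKappa n a c i / (n * a + c) ^ 2) := by
  unfold wDot
  rw [logD_baseB, zero_sub_baseB, one_div_one_div]
  simp

theorem logDDot_baseB (v : Fin (n + 1) → ℝ) (q' : ℝ) :
    logDDot (baseB n a c) 0 v q'
      = -(∑ m, (q' - v m) * baseKappa n a c m ^ 2) - (n + 1) * q' := by
  unfold logDDot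
  simp only [zero_sub_baseB, one_div, inv_pow, div_inv_eq_mul]
  simp

/-- The linearized hodograph system at the base point. -/
theorem base_velocity (ha : 0 < a) (hc : c ≠ 0) (hac : n = 0 ∨ ((n : ℝ) + 2) * |c| < a)
    {v : Fin (n + 1) → ℝ} {q' δ : ℝ}
    (hq : logD (baseB n a c) 0 * q' = (∑ m, v m / (0 - baseB n a c m)) + δ)
    (h : ∀ i, wDot (baseB n a c) 0 v q' i = -(a * c / (n * a + c)) *
      (2 * (∑ m, baseB n a c m * v m) - (∑ m, v m) * baseB n a c i - C0 (baseB n a c) * v i)) :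
    (δ = 0 → v = 0) ∧ (δ ≠ 0 → v ≠ 0) ∧
      (δ ≠ 0 → ((n : ℝ) - 1) * (a * c) * (2 * (n * a + c) + (n * c + a))
        + (n + 1) * (a * c - 1) * (a - n * c) ≠ 0 → ∑ m, v m ≠ 0) := by
  rw [logD_baseB] at hq
  simp only [zero_sub_baseB, div_div_eq_mul_div, div_one, Fin.sum_univ_castSucc, baseKappa_last,
    baseKappa_castSucc] at hq
  simp only [wDot_baseB, logDDot_baseB] at h
  -- For N = 1, 2C¹ - C⁰ b = 1 identically, so the right-hand side of the linearized equation
  -- vanishes and `a` plays no role in it.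
  rcases Nat.eq_zero_or_pos n with hn | hn
  · subst hn
    have h1 := h (Fin.last 0)
    rw [C0_baseB] at h1
    simp only [Fin.sum_univ_castSucc, Finset.univ_eq_empty, Finset.sum_empty, baseB,
      baseKappa_last] at h1 hq ⊢
    simp only [Nat.cast_zero, zero_mul, zero_add, zero_div] at h1 hq ⊢
    set u := v (Fin.last 0) with hu
    have hq' : q' = (u * c + δ) / c := by
      rw [eq_div_iff hc]
      linarith
    have h2 : u * (c ^ 2 + 1) * c + δ * (2 * c ^ 2 + 1) = 0 := by
      rw [hq'] at h1
      field_simp at h1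
      linear_combination (-1 : ℝ) * h1
    have hv : ∀ i, v i = u := fun i => by rw [hu, Subsingleton.elim (α := Fin 1) i (Fin.last 0)]
    have hne : δ ≠ 0 → u ≠ 0 := by
      intro hδ hu0
      rw [hu0] at h2
      have : δ * (2 * c ^ 2 + 1) = 0 := by linarith
      exact mul_ne_zero hδ (by positivity) this
    refine ⟨fun hδ => ?_, fun hδ hv0 => hne hδ (congrFun hv0 _), fun hδ _ => hne hδ⟩
    rw [hδ] at h2
    have h3 : u * ((c ^ 2 + 1) * c) = 0 := by linarith
    funext i
    rw [hv i]
    exact (mul_eq_zero.1 h3).resolve_right (mul_ne_zero (by positivity) hc)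
  · have hac' := hac.resolve_left hn.ne'
    have hn1 : (1 : ℝ) ≤ n := by exact_mod_cast hn
    have hc1 := neg_abs_le c
    have hc2 := le_abs_self c
    have habs := abs_nonneg c
    have hP0 : (n : ℝ) * a + c ≠ 0 := ne_of_gt (by nlinarith)
    have hR0 : (n : ℝ) * c + a ≠ 0 := ne_of_gt (by nlinarith)
    have hne : a ≠ c := ne_of_gt (by nlinarith)
    have hCR : C0 (baseB n a c) = -(n * c + a) / (a * c) := by
      rw [C0_baseB]
      field_simp
    have hC0 : C0 (baseB n a c) ≠ 0 := by
      rw [hCR]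
      exact div_ne_zero (neg_ne_zero.2 hR0) (mul_ne_zero ha.ne' hc)
    let k₀ : Fin n := ⟨0, hn⟩
    -- Subtracting the equations of two indices with the same coordinate leaves C⁰ a(a - c)/P times
    -- the difference of their velocities.
    have hgroup : ∀ k : Fin n, v k.castSucc = v k₀.castSucc := by
      intro k
      have e1 := h k.castSucc
      have e2 := h k₀.castSucc
      simp only [baseB, baseKappa_castSucc] at e1 e2
      have e3 : C0 (baseB n a c) * (a * (a - c) / (n * a + c))
          * (v k.castSucc - v k₀.castSucc) = 0 := by
        have : ∀ (x y z w : ℝ), x = y → z = w → (x - z) - (y - w) = 0 := by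
          intro x y z w h1 h2
          rw [h1, h2]
          ring
        rw [← this _ _ _ _ e1 e2]
        unfold baseB
        ring
      have e4 : C0 (baseB n a c) * (a * (a - c) / (n * a + c)) ≠ 0 :=
        mul_ne_zero hC0 (div_ne_zero (mul_ne_zero ha.ne' (sub_ne_zero.2 hne)) hP0)
      exact sub_eq_zero.1 ((mul_eq_zero.1 e3).resolve_left e4)
    have e1 := h k₀.castSucc
    have e2 := h (Fin.last n)
    set u₁ := v k₀.castSucc
    set u₂ := v (Fin.last n)
    set C := C0 (baseB n a c) with hCdef
    simp only [Fin.sum_univ_castSucc, baseB, baseKappa_castSucc, baseKappa_last, hgroup,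
      Finset.sum_const, Finset.card_univ, Fintype.card_fin, nsmul_eq_mul] at e1 e2 hq
    obtain ⟨I₁, I₂⟩ := two_group_equations (q' := q') (δ := δ) (C := C) ha.ne' hc hne rfl rfl hP0
      hR0 C0_baseB (by rw [hq]; ring) rfl rfl e1 e2
    obtain ⟨c1, c2, c3⟩ := two_group_conclusions hn1 ha hc hac' rfl rfl rfl I₁ I₂
    have hsum : ∑ m, v m = n * u₁ + u₂ := by
      simp [Fin.sum_univ_castSucc, hgroup, u₂]
    refine ⟨fun hδ => ?_, fun hδ hv => c2 hδ ⟨congrFun hv _, congrFun hv _⟩, fun hδ hgen => ?_⟩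
    · obtain ⟨d1, d2⟩ := c1 hδ
      funext i
      induction i using Fin.lastCases with
      | last => exact d2
      | cast i => rw [hgroup i]; exact d1
    · rw [hsum]
      exact c3 hδ hgen

end

/-- Existence of suitable base parameters. -/
theorem exists_base_parameters {l : ℝ} (hl : l ≠ 0) (n : ℕ) :
    ∃ a c : ℝ, 0 < a ∧ c ≠ 0 ∧ l * a ^ n * c = 1 ∧ (n = 0 ∨ ((n : ℝ) + 2) * |c| < a) ∧
      (l ≠ 1 → ((n : ℝ) - 1) * (a * c) * (2 * (n * a + c) + (n * c + a))
        + (n + 1) * (a * c - 1) * (a - n * c) ≠ 0) := by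
  rcases Nat.eq_zero_or_pos n with hn | hn
  · subst hn
    refine ⟨1, 1 / l, one_pos, by positivity, by field_simp, Or.inl rfl, fun _ => ?_⟩
    have : 0 < 2 * (1 / l) ^ 2 + 1 := by positivity
    simp only [Nat.cast_zero]
    intro h
    nlinarith
  have hn1 : (1 : ℝ) ≤ n := by exact_mod_cast hn
  have hl' : 0 < |l| := abs_pos.2 hl
  -- Take a large and let l aⁿ c = 1 fix c, which is then small. The cube is a convenient size: it
  -- gives |c| K ≤ 1 and, for n ≥ 2, also |ac| K ≤ 1.
  set K : ℝ := ((n : ℝ) + 2) ^ 3 with hK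
  have hKpos : 0 < K := by positivity
  set a : ℝ := max 1 (K / |l|) with ha
  have ha1 : 1 ≤ a := le_max_left _ _
  have ha2 : K ≤ |l| * a := by
    have : K / |l| ≤ a := le_max_right _ _
    rwa [div_le_iff₀ hl', mul_comm] at this
  have ha0 : 0 < a := by linarith
  set c : ℝ := 1 / (l * a ^ n) with hc
  have hc0 : c ≠ 0 := by
    rw [hc]
    have := pow_pos ha0 n
    positivity
  have hlc : l * a ^ n * c = 1 := by
    rw [hc]
    have := pow_pos ha0 n
    field_simp
  have hcabs : |c| * (|l| * a ^ n) = 1 := by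
    have h1 := congrArg abs hlc
    rw [abs_mul, abs_mul, abs_one, abs_of_pos (pow_pos ha0 n)] at h1
    linarith
  have hcK : |c| * K ≤ 1 := by
    rw [← hcabs]
    refine mul_le_mul_of_nonneg_left (ha2.trans ?_) (abs_nonneg c)
    refine mul_le_mul_of_nonneg_left ?_ hl'.le
    exact le_self_pow₀ ha1 hn.ne'
  have hKn : ((n : ℝ) + 2) * 9 ≤ K := by
    have h9 : (9 : ℝ) ≤ ((n : ℝ) + 2) ^ 2 := by nlinarith
    calc ((n : ℝ) + 2) * 9 ≤ (n + 2) * (n + 2) ^ 2 := by gcongr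
      _ = K := by rw [hK]; ring
  have hcn : ((n : ℝ) + 2) * |c| < a := by
    have := abs_nonneg c
    nlinarith
  refine ⟨a, c, ha0, hc0, hlc, Or.inr hcn, fun hl1 => ?_⟩
  have hc1 := neg_abs_le c
  have hc2 := le_abs_self c
  have habs := abs_nonneg c
  -- For n = 1 the expression is 2(ac - 1)(a - c), and l a c = 1 makes it vanish exactly when l = 1;
  -- this is the origin of the exclusion. For n ≥ 2, |ac| is small and the second summand, close to
  -- -(n+1)a, dominates.
  rcases eq_or_lt_of_le (Nat.succ_le_of_lt hn) with hn' | hn'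
  · have hn'' : n = 1 := hn'.symm
    have hcast : (n : ℝ) = 1 := by rw [hn'']; simp
    have hac1 : a * c - 1 ≠ 0 := by
      intro h0
      apply hl1
      rw [hn'', pow_one] at hlc
      have h1 : a * c = 1 := by linarith
      rw [mul_assoc, h1] at hlc
      linarith
    have h2 : a - c ≠ 0 := ne_of_gt (by nlinarith)
    rw [hcast]
    have h3 : ((1 : ℝ) - 1) * (a * c) * (2 * (1 * a + c) + (1 * c + a))
        + (1 + 1) * (a * c - 1) * (a - 1 * c) = 2 * ((a * c - 1) * (a - c)) := by ring
    rw [h3]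
    exact mul_ne_zero two_ne_zero (mul_ne_zero hac1 h2)
  · have hn2 : (2 : ℝ) ≤ n := by exact_mod_cast hn'
    have hacK : |a * c| * K ≤ 1 := by
      rw [abs_mul, abs_of_pos ha0, ← hcabs]
      have h1 : a * K ≤ |l| * a ^ n := by
        calc a * K ≤ a * (|l| * a) := mul_le_mul_of_nonneg_left ha2 ha0.le
          _ = |l| * a ^ 2 := by ring
          _ ≤ |l| * a ^ n := mul_le_mul_of_nonneg_left (pow_le_pow_right₀ ha1 hn') hl'.le
      calc a * |c| * K = |c| * (a * K) := by ring
        _ ≤ |c| * (|l| * a ^ n) := mul_le_mul_of_nonneg_left h1 habs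
    have hη : |a * c| * (((n : ℝ) + 2) * 9) ≤ 1 :=
      (mul_le_mul_of_nonneg_left hKn (abs_nonneg _)).trans hacK
    have hη2 : |c| * (((n : ℝ) + 2) * 9) ≤ 1 :=
      (mul_le_mul_of_nonneg_left hKn habs).trans hcK
    set y := a * c with hy
    have hy1 := neg_abs_le y
    have hy2 := le_abs_self y
    have hyabs := abs_nonneg y
    have hA : 2 * ((n : ℝ) * a + c) + (n * c + a) ≤ (2 * n + 2) * a := by nlinarith
    have hA0 : 0 ≤ 2 * ((n : ℝ) * a + c) + (n * c + a) := by nlinarith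
    have hB : a / 2 ≤ a - n * c := by nlinarith
    have h1 : ((n : ℝ) - 1) * y * (2 * (n * a + c) + (n * c + a)) ≤ (n + 1) * (a / 4) := by
      calc ((n : ℝ) - 1) * y * (2 * (n * a + c) + (n * c + a))
          ≤ ((n : ℝ) - 1) * |y| * (2 * (n * a + c) + (n * c + a)) := by
            gcongr
        _ ≤ ((n : ℝ) - 1) * |y| * ((2 * n + 2) * a) := by
            refine mul_le_mul_of_nonneg_left hA (mul_nonneg (by linarith) hyabs)
        _ = (n + 1) * a * (2 * ((n - 1) * |y|)) := by ring
        _ ≤ (n + 1) * a * (1 / 4) := by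
            refine mul_le_mul_of_nonneg_left (by nlinarith) (by positivity)
        _ = (n + 1) * (a / 4) := by ring
    have h2 : ((n : ℝ) + 1) * (y - 1) * (a - n * c) ≤ -((n + 1) * (a / 2 * (35 / 36))) := by
      have hy3 : y - 1 ≤ -(35 / 36) := by nlinarith
      have h3 : (35 / 36 : ℝ) * (a / 2) ≤ (1 - y) * (a - n * c) :=
        mul_le_mul (by linarith) hB (by positivity) (by linarith)
      nlinarith
    have h3 : 0 < ((n : ℝ) + 1) * a := by positivity
    apply ne_of_lt
    linarith

end GeodHydro

/-! ### The one-parameter family. -/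

namespace GeodHydro

open Filter Topology

variable {N n : ℕ} {a c : ℝ}

/-- The hodograph system written through a family of branches. -/
noncomputable def defect (Q : ℝ × (Fin N → ℝ) → ℝ) (y : (ℝ × (ℝ × ℝ)) × (Fin N → ℝ))
    (i : Fin N) : ℝ :=
  regW Q (y.1.1, y.2) i - (y.1.2.1 + y.1.2.2 * (2 * C1 y.2 - C0 y.2 * y.2 i))

theorem contDiffAt_defect {Q : ℝ × (Fin N → ℝ) → ℝ} {y : (ℝ × (ℝ × ℝ)) × (Fin N → ℝ)}
    (hQ : ContDiffAt ℝ ω Q (y.1.1, y.2)) : ContDiffAt ℝ ω (defect Q) y := by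
  refine contDiffAt_pi.2 fun i => ?_
  unfold defect
  have hp : ContDiff ℝ ω (fun y : (ℝ × (ℝ × ℝ)) × (Fin N → ℝ) =>
      y.1.2.1 + y.1.2.2 * (2 * C1 y.2 - C0 y.2 * y.2 i)) := by
    have h1 := (contDiff_C0 (N := N)).comp (contDiff_snd (𝕜 := ℝ) (n := ω) (E := ℝ × (ℝ × ℝ)))
    have h2 := (contDiff_C1 (N := N)).comp (contDiff_snd (𝕜 := ℝ) (n := ω) (E := ℝ × (ℝ × ℝ)))
    simp only [Function.comp_def] at h1 h2
    fun_prop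
  refine ContDiffAt.sub ?_ hp.contDiffAt
  exact (contDiffAt_regW hQ i).comp y
    (f := fun y : (ℝ × (ℝ × ℝ)) × (Fin N → ℝ) => (y.1.1, y.2)) (by fun_prop)

theorem exists_nhds_injOn {f : ℝ → ℝ} {f' x : ℝ} (hf : HasStrictDerivAt f f' x) (hf' : f' ≠ 0) :
    ∃ s : Set ℝ, IsOpen s ∧ x ∈ s ∧ Set.InjOn f s := by
  have h := HasStrictFDerivAt.eventually_left_inverse (hf.hasStrictFDerivAt_equiv hf')
  obtain ⟨s, hs, hso, hxs⟩ := mem_nhds_iff.1 h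
  exact ⟨s, hso, hxs, fun y hy z hz hyz => by rw [← hs hy, ← hs hz, hyz]⟩

/-- A curve of solutions of hodograph systems through the base point, at fixed `(x, t)`, has a
velocity satisfying the linearized system. -/
theorem curve_velocity {γ : ℝ → Fin (n + 1) → ℝ} {q l : ℝ → ℝ} {v : Fin (n + 1) → ℝ}
    {q' l' x t τ : ℝ} {i : Fin (n + 1)}
    (hγ : HasDerivAt γ v τ) (hq : HasDerivAt q q' τ) (hl : HasDerivAt l l' τ)
    (hγ0 : γ τ = baseB n a c) (hq0 : q τ = 0) (hl0 : l τ ≠ 0)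
    (hP : logD (baseB n a c) 0 ≠ 0)
    (hs : ∀ᶠ r in 𝓝 τ, surface (γ r) (q r) = l r)
    (ht : t = -(a * c / (n * a + c)))
    (h : HasDerivAt (fun r => W (γ r) (q r) i
      - (x + t * (2 * C1 (γ r) - C0 (γ r) * γ r i))) 0 τ) :
    logD (baseB n a c) 0 * q' = (∑ m, v m / (0 - baseB n a c m)) + l' / l τ ∧
    wDot (baseB n a c) 0 v q' i = -(a * c / (n * a + c)) *
      (2 * (∑ m, baseB n a c m * v m) - (∑ m, v m) * baseB n a c i - C0 (baseB n a c) * v i) := by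
  have h0 := sub_ne_zero_of_surface_ne_zero (hs.self_of_nhds.trans_ne hl0)
  have h1 := speed_eq hγ hq hl hs hl0
  have h2 := hasDerivAt_W hγ hq h0 (by rw [hγ0, hq0]; exact hP) i
  have h3 := hasDerivAt_hodographLHS hγ (hasDerivAt_const τ x) (hasDerivAt_const τ t) i
  have h4 := h.unique (h2.sub h3)
  rw [hγ0, hq0] at h1 h4
  refine ⟨h1, ?_⟩
  rw [ht] at h4
  linarith

/-- W_i = C⁰ κ_i/P with κ_i = -1/b_i. Since κ_i is a root of (κ - a)(κ - c), κ_i = (a + c) + a c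
b_i, so W_i is affine in b_i with the same coefficients for all i. This yields the values of t₀ and
x₀. -/
theorem W_baseB (ha : a ≠ 0) (hc : c ≠ 0) (hP : (n : ℝ) * a + c ≠ 0) (i : Fin (n + 1)) :
    W (baseB n a c) 0 i = C0 (baseB n a c) * ((a + c) / (n * a + c))
      + -(a * c / (n * a + c)) * (-(C0 (baseB n a c) * baseB n a c i)) := by
  have h1 : W (baseB n a c) 0 i
      = C0 (baseB n a c) * baseKappa n a c i / (n * a + c) := by
    have h := logD_baseB (n := n) (a := a) (c := c)
    unfold logD at h
    unfold W
    rw [h, zero_sub_baseB]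
    simp
    ring
  rw [h1]
  unfold baseB
  induction i using Fin.lastCases with
  | last =>
    rw [baseKappa_last]
    field_simp
    ring
  | cast i =>
    rw [baseKappa_castSucc]
    field_simp
    ring

theorem exists_one_parameter_family (n : ℕ) {l₀ : ℝ} (hl₀ : l₀ ≠ 0) :
      ∃ (Λ : Set ℝ) (Ω : Set (Fin (n + 1) → ℝ)) (U : Set (ℝ × ℝ))
        (q : ℝ → (Fin (n + 1) → ℝ) → ℝ) (β : ℝ → ℝ × ℝ → Fin (n + 1) → ℝ),
        IsOpen Λ ∧ l₀ ∈ Λ ∧ 0 ∉ Λ ∧ IsOpen U ∧ U.Nonempty ∧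
        (∀ l ∈ Λ, IsInverseBranch l Ω (q l)) ∧
        ContDiffOn ℝ ∞ (fun y : ℝ × (Fin (n + 1) → ℝ) => q y.1 y.2) (Λ ×ˢ Ω) ∧
        ContDiffOn ℝ ∞ (fun y : ℝ × (ℝ × ℝ) => β y.1 y.2) (Λ ×ˢ U) ∧
        (∀ l ∈ Λ, ∀ z ∈ U, β l z ∈ Ω ∧ C0 (β l z) ≠ 0 ∧
          (2 ≤ n + 1 → ∃ i j, β l z i ≠ β l z j) ∧
          ∀ b ∈ Ω, Hodograph z.1 z.2 b (q l b) ↔ b = β l z) ∧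
        (∀ l ∈ Λ, ∀ l' ∈ Λ, l ≠ l' → ∃ z ∈ U, β l z ≠ β l' z) ∧
        (l₀ ≠ 1 → ∀ l ∈ Λ, ∀ l' ∈ Λ, l ≠ l' → ∃ z ∈ U, C0 (β l z) ≠ C0 (β l' z)) := by
  obtain ⟨a, c, ha, hc, hlac, hac, hgen⟩ := exists_base_parameters hl₀ n
  have hPR : (n : ℝ) * a + c ≠ 0 ∧ (n : ℝ) * c + a ≠ 0 ∧ (n ≠ 0 → a ≠ c) := by
    rcases Nat.eq_zero_or_pos n with hn | hn
    · simp [hn, hc, ha.ne']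
    · have hac' := hac.resolve_left hn.ne'
      have hn1 : (1 : ℝ) ≤ n := by exact_mod_cast hn
      have hc1 := neg_abs_le c
      have hc2 := le_abs_self c
      have habs := abs_nonneg c
      exact ⟨ne_of_gt (by nlinarith), ne_of_gt (by nlinarith), fun _ => ne_of_gt (by nlinarith)⟩
  obtain ⟨hP0, hR0, hne⟩ := hPR
  set b₀ := baseB n a c with hb₀
  have hlogD : logD b₀ 0 ≠ 0 := by rw [hb₀, logD_baseB]; exact hP0
  have hsurf : surface b₀ 0 = l₀ := surface_baseB hlac
  have hC0 : C0 b₀ ≠ 0 := by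
    have : C0 b₀ = -(n * c + a) / (a * c) := by
      rw [hb₀, C0_baseB]
      field_simp
    rw [this]
    exact div_ne_zero (neg_ne_zero.2 hR0) (mul_ne_zero ha.ne' hc)
  have hderiv : deriv (surface b₀) 0 ≠ 0 := by
    rw [deriv_surface (sub_ne_zero_of_surface_ne_zero (hsurf.trans_ne hl₀)), hsurf]
    exact mul_ne_zero hl₀ hlogD
  obtain ⟨A, B, V, Q, hA, hB, hV, hlA, hbB, hqV, hQ, hVd, hQiff⟩ := exists_branch hsurf hderiv
  have hs : ∀ l ∈ A, ∀ b ∈ B, surface b (Q (l, b)) = l := fun l hl b hb =>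
    (hQiff l hl b hb _ (hVd l hl b hb).1).2 rfl
  have hd : ∀ l ∈ A, ∀ b ∈ B, deriv (surface b) (Q (l, b)) ≠ 0 := fun l hl b hb =>
    (hVd l hl b hb).2
  have hQ0 : Q (l₀, b₀) = 0 := ((hQiff l₀ hlA b₀ hbB 0 hqV).1 hsurf).symm
  have hQat : ContDiffAt ℝ ω Q (l₀, b₀) :=
    hQ.contDiffAt ((hA.prod hB).mem_nhds (Set.mk_mem_prod hlA hbB))
  have hreg : ∀ l ∈ A, l ≠ 0 → ∀ b ∈ B, ∀ i, regW Q (l, b) i = W b (Q (l, b)) i :=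
    fun l hl hl0 b hb i => regW_eq hA hB hQ hs hd hl hl0 hb i
  let t₀ : ℝ := -(a * c / (n * a + c))
  let x₀ : ℝ := C0 b₀ * ((a + c) / (n * a + c)) - 2 * t₀ * C1 b₀
  let p₀ : ℝ × (ℝ × ℝ) := (l₀, (x₀, t₀))
  have hf : ContDiffAt ℝ ω (defect Q) (p₀, b₀) := contDiffAt_defect hQat
  have hf0 : defect Q (p₀, b₀) = 0 := by
    funext i
    simp only [defect, p₀, Pi.zero_apply]
    rw [hreg l₀ hlA hl₀ b₀ hbB, hQ0, W_baseB ha.ne' hc hP0]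
    simp only [x₀, t₀, ← hb₀]
    ring
  have hker : ∀ u, fderiv ℝ (defect Q) (p₀, b₀) (0, u) = 0 → u = 0 := by
    intro u hu
    have h1 := hasDerivAt_line (hf.differentiableAt (by simp)) u
    rw [hu] at h1
    have hline : HasDerivAt (fun r : ℝ => b₀ + r • u) u 0 := by
      simpa using ((hasDerivAt_id (0 : ℝ)).smul_const u).const_add b₀
    have hz0 : b₀ + (0 : ℝ) • u = b₀ := by simp
    have hev : ∀ᶠ r : ℝ in 𝓝 0, b₀ + r • u ∈ B :=
      hline.continuousAt.preimage_mem_nhds (by rw [hz0]; exact hB.mem_nhds hbB)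
    have h2 := hasDerivAt_line (hQat.differentiableAt (by simp)) u
    have h3 := fun i => curve_velocity (a := a) (c := c) (x := x₀) (t := t₀) (i := i) hline h2
      (hasDerivAt_const (0 : ℝ) l₀) hz0 (by rw [hz0]; exact hQ0) hl₀ hlogD
      (hev.mono fun r hr => hs l₀ hlA _ hr) rfl
      ((hasDerivAt_pi.1 h1 i).congr_of_eventuallyEq (hev.mono fun r hr => by
        simp only [defect, p₀]
        rw [hreg l₀ hlA hl₀ _ hr]))
    exact (base_velocity ha hc hac (h3 0).1 fun i => (h3 i).2).1 (by simp)
  have hO : {y : (ℝ × (ℝ × ℝ)) × (Fin (n + 1) → ℝ) | y.1.1 ∈ A ∧ y.2 ∈ B ∧ C0 y.2 ≠ 0 ∧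
      (n ≠ 0 → y.2 0 ≠ y.2 (Fin.last n))} ∈ 𝓝 (p₀, b₀) := by
    have h1 : ∀ᶠ y : (ℝ × (ℝ × ℝ)) × (Fin (n + 1) → ℝ) in 𝓝 (p₀, b₀), y.1.1 ∈ A := by
      have : ContinuousAt (fun y : (ℝ × (ℝ × ℝ)) × (Fin (n + 1) → ℝ) => y.1.1) (p₀, b₀) := by
        fun_prop
      exact this.preimage_mem_nhds (hA.mem_nhds hlA)
    have h2 : ∀ᶠ y : (ℝ × (ℝ × ℝ)) × (Fin (n + 1) → ℝ) in 𝓝 (p₀, b₀), y.2 ∈ B :=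
      continuousAt_snd.preimage_mem_nhds (hB.mem_nhds hbB)
    have h3 : ∀ᶠ y : (ℝ × (ℝ × ℝ)) × (Fin (n + 1) → ℝ) in 𝓝 (p₀, b₀), C0 y.2 ≠ 0 :=
      ((contDiff_C0.continuous.comp continuous_snd).continuousAt).eventually_ne hC0
    have h4 : ∀ᶠ y : (ℝ × (ℝ × ℝ)) × (Fin (n + 1) → ℝ) in 𝓝 (p₀, b₀),
        n ≠ 0 → y.2 0 ≠ y.2 (Fin.last n) := by
      by_cases hn : n = 0
      · exact Eventually.of_forall fun y h => absurd hn h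
      · have hci : ∀ i, ContinuousAt (fun y : (ℝ × (ℝ × ℝ)) × (Fin (n + 1) → ℝ) => y.2 i)
            (p₀, b₀) := fun i => by fun_prop
        have hval : b₀ 0 ≠ b₀ (Fin.last n) := by
          have hz : (0 : Fin (n + 1)) = Fin.castSucc ⟨0, Nat.pos_of_ne_zero hn⟩ := rfl
          rw [hb₀, hz]
          simp only [baseB, baseKappa_castSucc, baseKappa_last]
          intro h
          apply hne hn
          rw [div_eq_div_iff ha.ne' hc] at h
          linarith
        exact (((hci 0).ne_iff_eventually_ne (hci (Fin.last n))).1 hval).mono fun y hy _ => hy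
    filter_upwards [h1, h2, h3, h4] with y a1 a2 a3 a4
    exact ⟨a1, a2, a3, a4⟩
  obtain ⟨P, Ω, β, hP, hΩ, hpP, hbΩ, hβ, hsub, hmaps, hiff⟩ :=
    exists_implicit_family hf hf0 hker hO
  obtain ⟨L, U, hL, hlL, hU, hzU, hLU⟩ := mem_nhds_prod_iff'.1 (hP.mem_nhds hpP)
  have hβ0 : β p₀ = b₀ := ((hiff p₀ hpP b₀ hbΩ).1 hf0).symm
  have hLA : ∀ l ∈ L, l ∈ A := fun l hl =>
    (hsub (Set.mk_mem_prod (hLU (Set.mk_mem_prod hl hzU)) hbΩ)).1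
  have hΩB : Ω ⊆ B := fun b hb => (hsub (Set.mk_mem_prod hpP hb)).2.1
  -- The family followed in λ at fixed (x₀, t₀). Its velocity solves the linearized system with δ =
  -- 1/l₀ ≠ 0, so some component, and for l₀ ≠ 1 also C⁰, is injective in λ near l₀.
  let γ : ℝ → Fin (n + 1) → ℝ := fun l => β (l, (x₀, t₀))
  have hγc : ContDiffAt ℝ ω γ l₀ :=
    (hβ.contDiffAt (hP.mem_nhds hpP)).comp l₀ (f := fun l : ℝ => (l, (x₀, t₀))) (by fun_prop)
  obtain ⟨v, hγ⟩ : ∃ v, HasDerivAt γ v l₀ :=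
    ⟨_, (hγc.differentiableAt (by simp)).hasDerivAt⟩
  have hγ0 : γ l₀ = b₀ := hβ0
  have hevL : ∀ᶠ l : ℝ in 𝓝 l₀, l ∈ L ∧ l ≠ 0 :=
    Filter.inter_mem (hL.mem_nhds hlL) (isOpen_ne.mem_nhds hl₀)
  have hγΩ : ∀ l ∈ L, γ l ∈ Ω := fun l hl => hmaps _ (hLU (Set.mk_mem_prod hl hzU))
  obtain ⟨q', hqγ⟩ : ∃ q', HasDerivAt (fun l => Q (l, γ l)) q' l₀ := by
    have h1 : HasFDerivAt Q (fderiv ℝ Q (l₀, b₀)) (l₀, γ l₀) := by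
      rw [hγ0]
      exact (hQat.differentiableAt (by simp)).hasFDerivAt
    exact ⟨_, h1.comp_hasDerivAt l₀ ((hasDerivAt_id l₀).prodMk hγ)⟩
  have hvel := fun i => curve_velocity (a := a) (c := c) (x := x₀) (t := t₀) (i := i) hγ hqγ
    (hasDerivAt_id l₀) hγ0 (by rw [hγ0]; exact hQ0) hl₀ hlogD
    (hevL.mono fun l hl => hs l (hLA l hl.1) _ (hΩB (hγΩ l hl.1))) rfl
    ((hasDerivAt_const l₀ (0 : ℝ)).congr_of_eventuallyEq (hevL.mono fun l hl => by
      have h1 := congrFun ((hiff _ (hLU (Set.mk_mem_prod hl.1 hzU)) _ (hγΩ l hl.1)).2 rfl) i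
      simp only [defect, Pi.zero_apply] at h1
      rw [hreg l (hLA l hl.1) hl.2 _ (hΩB (hγΩ l hl.1))] at h1
      exact h1))
  obtain ⟨-, hv1, hv2⟩ := base_velocity ha hc hac (hvel 0).1 fun i => (hvel i).2
  have hδ : (1 : ℝ) / id l₀ ≠ 0 := one_div_ne_zero hl₀
  obtain ⟨m, hm⟩ := Function.ne_iff.1 (hv1 hδ)
  obtain ⟨L₁, hL₁, hlL₁, hinj₁⟩ : ∃ s : Set ℝ, IsOpen s ∧ l₀ ∈ s ∧ Set.InjOn (fun l => γ l m) s := by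
    have hc1 : ContDiffAt ℝ ω (fun l => γ l m) l₀ := contDiffAt_pi.1 hγc m
    exact exists_nhds_injOn (hc1.hasStrictDerivAt' (hasDerivAt_pi.1 hγ m) (by simp)) hm
  obtain ⟨L₂, hL₂, hlL₂, hinj₂⟩ : ∃ s : Set ℝ, IsOpen s ∧ l₀ ∈ s ∧
      (l₀ ≠ 1 → Set.InjOn (fun l => C0 (γ l)) s) := by
    by_cases h1 : l₀ = 1
    · exact ⟨Set.univ, isOpen_univ, trivial, fun h => absurd h1 h⟩
    · have hc1 : ContDiffAt ℝ ω (fun l => C0 (γ l)) l₀ := contDiff_C0.contDiffAt.comp l₀ hγc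
      obtain ⟨s, hs1, hs2, hs3⟩ := exists_nhds_injOn
        (hc1.hasStrictDerivAt' (hasDerivAt_C0 hγ) (by simp)) (hv2 hδ (hgen h1))
      exact ⟨s, hs1, hs2, fun _ => hs3⟩
  let Λ : Set ℝ := ((L ∩ {l | l ≠ 0}) ∩ L₁) ∩ L₂
  have hmem : ∀ l ∈ Λ, ∀ z ∈ U, (l, z) ∈ P := fun l hl z hz =>
    hLU (Set.mk_mem_prod hl.1.1.1 hz)
  refine ⟨Λ, Ω, U, fun l b => Q (l, b), fun l z => β (l, z),
    ((hL.inter isOpen_ne).inter hL₁).inter hL₂, ⟨⟨⟨hlL, hl₀⟩, hlL₁⟩, hlL₂⟩,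
    fun h => h.1.1.2 rfl, hU, ⟨_, hzU⟩, ?_, ?_, ?_, ?_, ?_, ?_⟩
  · intro l hl
    exact isInverseBranch_of_family hΩ hΩB hQ hs hd (hLA l hl.1.1.1)
  · exact (hQ.of_le (by simp)).mono fun y hy => ⟨hLA _ hy.1.1.1.1, hΩB hy.2⟩
  · exact (hβ.of_le (by simp)).mono fun y hy => hmem _ hy.1 _ hy.2
  · intro l hl z hz
    have hβΩ := hmaps _ (hmem l hl z hz)
    obtain ⟨-, -, h3, h4⟩ := hsub (Set.mk_mem_prod (hmem l hl z hz) hβΩ)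
    refine ⟨hβΩ, h3, fun hn => ⟨0, Fin.last n, h4 (by omega)⟩, fun b hb => ?_⟩
    rw [← hiff _ (hmem l hl z hz) b hb, funext_iff]
    refine forall_congr' fun i => ?_
    simp only [defect, hreg l (hLA l hl.1.1.1) hl.1.1.2 b (hΩB hb), Pi.zero_apply]
    rw [sub_eq_zero, eq_comm]
  · intro l hl l' hl' hll
    exact ⟨_, hzU, fun h => hll (hinj₁ hl.1.2 hl'.1.2 (congrFun h m))⟩
  · intro h1 l hl l' hl' hll
    exact ⟨_, hzU, fun h => hll (hinj₂ h1 hl.2 hl'.2 h)⟩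

end GeodHydro

/-! ### Assembly of the four assertions. -/

theorem theorem1 (N : ℕ) (hN : 1 ≤ N) :
    -- every solution of the hodograph system is a solution of the hydrodynamic type system
    (∀ (l : ℝ) (Ω : Set (Fin N → ℝ)) (q : (Fin N → ℝ) → ℝ) (U : Set (ℝ × ℝ))
        (b : ℝ × ℝ → Fin N → ℝ),
      l ≠ 0 → IsInverseBranch l Ω q → IsOpen U → ContDiffOn ℝ 1 b U →
      (∀ z ∈ U, b z ∈ Ω ∧ C0 (b z) ≠ 0 ∧ Hodograph z.1 z.2 (b z) (q (b z))) →
      SolvesSystem U b ∧ HasPolynomialIntegral U b) ∧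
    -- near every nonzero value of the parameter there is a one-parameter family of solutions
    (∀ l₀ : ℝ, l₀ ≠ 0 →
      ∃ (Λ : Set ℝ) (Ω : Set (Fin N → ℝ)) (U : Set (ℝ × ℝ))
        (q : ℝ → (Fin N → ℝ) → ℝ) (β : ℝ → ℝ × ℝ → Fin N → ℝ),
        IsOpen Λ ∧ l₀ ∈ Λ ∧ 0 ∉ Λ ∧ IsOpen U ∧ U.Nonempty ∧
        (∀ l ∈ Λ, IsInverseBranch l Ω (q l)) ∧
        ContDiffOn ℝ ∞ (fun y : ℝ × (Fin N → ℝ) => q y.1 y.2) (Λ ×ˢ Ω) ∧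
        ContDiffOn ℝ ∞ (fun y : ℝ × (ℝ × ℝ) => β y.1 y.2) (Λ ×ˢ U) ∧
        (∀ l ∈ Λ, ∀ z ∈ U, β l z ∈ Ω ∧ C0 (β l z) ≠ 0 ∧
          (2 ≤ N → ∃ i j, β l z i ≠ β l z j) ∧
          ∀ b ∈ Ω, Hodograph z.1 z.2 b (q l b) ↔ b = β l z) ∧
        (∀ l ∈ Λ, SolvesSystem U (β l) ∧ HasPolynomialIntegral U (β l)) ∧
        (∀ l ∈ Λ, ∀ l' ∈ Λ, l ≠ l' → ∃ z ∈ U, β l z ≠ β l' z) ∧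
        (l₀ ≠ 1 → ∀ l ∈ Λ, ∀ l' ∈ Λ, l ≠ l' → ∃ z ∈ U, C0 (β l z) ≠ C0 (β l' z))) ∧
    -- every solution of a superposed hodograph system is a solution
    (∀ (M : ℕ) (l σ : Fin M → ℝ) (Ω : Set (Fin N → ℝ)) (q : Fin M → (Fin N → ℝ) → ℝ)
        (U : Set (ℝ × ℝ)) (b : ℝ × ℝ → Fin N → ℝ),
      (∀ j, l j ≠ 0 ∧ IsInverseBranch (l j) Ω (q j)) → IsOpen U → ContDiffOn ℝ 1 b U →
      (∀ z ∈ U, b z ∈ Ω ∧ C0 (b z) ≠ 0 ∧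
        SuperHodograph z.1 z.2 (b z) σ (fun j => q j (b z))) →
      SolvesSystem U b ∧ HasPolynomialIntegral U b) ∧
    -- multiparameter families of solutions with pairwise distinct components
    (∀ M : ℕ, N ≤ M →
      ∃ (Λ S : Set (Fin M → ℝ)) (Ω : Set (Fin N → ℝ)) (U : Set (ℝ × ℝ))
        (q : Fin M → ℝ → (Fin N → ℝ) → ℝ)
        (β : (Fin M → ℝ) → (Fin M → ℝ) → ℝ × ℝ → Fin N → ℝ),
        IsOpen Λ ∧ Λ.Nonempty ∧ IsOpen S ∧ S.Nonempty ∧ IsOpen U ∧ U.Nonempty ∧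
        (∀ l ∈ Λ, Function.Injective l ∧
          ∀ j, l j ≠ 0 ∧ IsInverseBranch (l j) Ω (q j (l j))) ∧
        (∀ j, ContDiffOn ℝ ∞
          (fun y : (Fin M → ℝ) × (Fin N → ℝ) => q j (y.1 j) y.2) (Λ ×ˢ Ω)) ∧
        ContDiffOn ℝ ∞
          (fun y : ((Fin M → ℝ) × (Fin M → ℝ)) × (ℝ × ℝ) => β y.1.1 y.1.2 y.2)
          ((Λ ×ˢ S) ×ˢ U) ∧
        (∀ l ∈ Λ, ∀ σ ∈ S, ∀ z ∈ U, β l σ z ∈ Ω ∧ C0 (β l σ z) ≠ 0 ∧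
          Function.Injective (β l σ z) ∧
          ∀ b ∈ Ω, SuperHodograph z.1 z.2 b σ (fun j => q j (l j) b) ↔ b = β l σ z) ∧
        (∀ l ∈ Λ, ∀ σ ∈ S, SolvesSystem U (β l σ) ∧ HasPolynomialIntegral U (β l σ)) ∧
        (M = N → ∀ l ∈ Λ, ∀ σ ∈ S, ∀ σ' ∈ S, σ ≠ σ' →
          ∃ z ∈ U, β l σ z ≠ β l σ' z)) := by
  refine ⟨fun l Ω q U b hl hq hU hb h => hodograph_conclusions hN hl hq hU hb h, fun l₀ hl₀ => ?_,
    fun M l σ Ω q U b hq hU hb h => superHodograph_conclusions hN hq hU hb h, fun M hNM => ?_⟩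
  · obtain ⟨n, rfl⟩ : ∃ n, N = n + 1 := ⟨N - 1, by omega⟩
    obtain ⟨Λ, Ω, U, q, β, h1, h2, h3, h4, h5, h6, h7, h8, h9, h10, h11⟩ :=
      exists_one_parameter_family n hl₀
    refine ⟨Λ, Ω, U, q, β, h1, h2, h3, h4, h5, h6, h7, h8, h9, fun l hl => ?_, h10, h11⟩
    have hl0 : l ≠ 0 := fun h => h3 (h ▸ hl)
    have hβ : ContDiffOn ℝ 1 (β l) U :=
      (h8.of_le (by simp)).comp (f := fun z : ℝ × ℝ => (l, z)) (by fun_prop)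
        fun z hz => Set.mk_mem_prod hl hz
    refine hodograph_conclusions hN hl0 (h6 l hl) h4 hβ fun z hz => ?_
    obtain ⟨a1, a2, -, a4⟩ := h9 l hl z hz
    exact ⟨a1, a2, (a4 _ a1).2 rfl⟩
  · obtain ⟨Λ, S, Ω, U, q, β, h1, h2, h3, h4, h5, h6, h7, h8, h9, h10, h11⟩ :=
      exists_multiparameter_family hN hNM
    refine ⟨Λ, S, Ω, U, q, β, h1, h2, h3, h4, h5, h6, h7, h8, h9, h10, fun l hl σ hσ => ?_, h11⟩
    have hβ : ContDiffOn ℝ 1 (β l σ) U :=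
      (h9.of_le (by simp)).comp (f := fun z : ℝ × ℝ => ((l, σ), z)) (by fun_prop)
        fun z hz => Set.mk_mem_prod (Set.mk_mem_prod hl hσ) hz
    refine superHodograph_conclusions (σ := σ) hN (fun j => (h7 l hl).2 j) h5 hβ fun z hz => ?_
    obtain ⟨a1, a2, -, a4⟩ := h10 l hl σ hσ z hz
    exact ⟨a1, a2, (a4 _ a1).2 rfl⟩
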